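/- Let $K$ be a field of characteristic $p$ ($p$ prime or $p=0$), and let $V$ be a two-dimensional braided vector space of diagonal type over $K$ with basis $x_1,x_2$ and braiding $c(x_i\otimes x_j)=q_{ij}\,x_j\otimes x_i$, $q_{ij}\in K^\times$. Let $\pi:T(V)\to B(V)$ be the canonical map from the tensor algebra to the Nichols algebra (the quotient of $T(V)$ by its largest ideal and coideal in degrees $\ge 2$). Grade $T(V)$ by $\mathbb Z^2$ with $\deg x_i=\alpha_i$, let $\chi$ be the bicharacter on $\mathbb Z^2$ with $\chi(\alpha_i,\alpha_j)=q_{ij}$, and put $q=q_{11}$, $r=q_{12}q_{21}$, $s=q_{22}$. For homogeneous $y$, let $(\mathrm{ad}\,x_1)(y)=x_1y-\chi(\alpha_1,\deg y)\,yx_1$, and let $d_1$ be the skew-derivation of $T(V)$ with $d_1(x_j)=\delta_{1j}$ and $d_1(yz)=d_1(y)z+\chi(\deg y,\alpha_1)\,y\,d_1(z)$. Put $(k)_q=\sum_{i=0}^{k-1}q^i$, $(k)_q^!=\prod_{i=1}^k(i)_q$, $b_k=\prod_{i=0}^{k-1}(1-q^ir)$. Let $u_0=x_2$ and $u_k=x_1u_{k-1}-q^{k-1}q_{12}u_{k-1}x_1$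 for $k\ge1$; let $\hat u_k=\frac{1}{(k)_q^!b_k}u_k$ if $(k)_q^!b_k\neq0$ and $\hat u_k=0$ otherwise. Let $U_n=\mathrm{span}\{u_iu_{n-i}:0\le i\le n\}$, $U_n'=\mathrm{span}\{u_iu_{n-i}:0\le i\le n-1\}$, and, if $(k)_q^!b_k\ne0$, $$P_k=\sum_{i=0}^k(-q_{21})^iq^{i(i-1)/2}\,\hat u_i\hat u_{k-i}.$$ Define $J\subseteq\mathbb N_0$ recursively: $j\in J$ if and only if $q^{j(j-1)/2}(-r)^js=-1$ and, for every $n\in J$ with $n<j$, $\left(\tfrac{j-n}2\right)_{q^{n+j-1}r^2}=0$ if $j-n$ is even and $(j-n)_{-q^{(n+j-1)/2}r}=0$ if $j-n$ is odd. Let $J_1$ be the set of $j\in J$ such that $q^{j(j-1)/2}(-r)^js=-1$ and $q^{n+j-1}r^2\ne1$ for all $n\in J$ with $n<j$. Let $J_2$ be the set of $j\in J$ for which there is some $n\in J$ with $n<j$ such that $q^{n+j-1}r^2=1$ and $2p\mid j-n$ if $j-n$ is even, and $q^{(n+j-1)/2}r=-1$ and $p\mid j-n$ if $j-n$ is odd.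 **Proposition.** Let $m\in\mathbb N_0$ with $(m)_q^!\,b_m\neq0$. For each $n\in J_2\cap[0,m]$ there is a unique $j_n\in J_1$ with $j_n<n$ and $q^{n+j_n-1}r^2=1$, and there is a unique $L_n\in U_n'\cap\ker\pi$ with $-q_{21}^{-1}d_1(L_n)=(\mathrm{ad}\,x_1)^{n-j_n-1}(P_{j_n})$. The elements $$(\mathrm{ad}\,x_1)^{m-j}(P_j)\ \ (j\in J_1\cap[0,m]),\qquad (\mathrm{ad}\,x_1)^{m-n}(L_n)\ \ (n\in J_2\cap[0,m])$$ all lie in $\ker\pi\cap U_m$ and, taken together as one family, are linearly independent. -/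

import Mathlib

open scoped TensorProduct

noncomputable section

namespace NicholsDiag

universe u v w

/-! ### The tensor algebra and the Nichols algebra of a braided vector space of diagonal type

`V` is a vector space with basis `x` and braiding `c (x i ⊗ x j) = Q i j • (x j ⊗ x i)`. -/

section General

variable {K : Type u} [Field K] {V : Type v} [AddCommGroup V] [Module K V] {ι : Type w}

/-- The generator `x_i` of the tensor algebra `T(V)`. -/
def gen (x : Module.Basis ι K V) (i : ι) : TensorAlgebra K V := TensorAlgebra.ι K (x i)

/-- The diagonal algebra automorphism of `T(V)` with `x_j ↦ a_j x_j`. -/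
def diagHom (x : Module.Basis ι K V) (a : ι → K) : TensorAlgebra K V →ₐ[K] TensorAlgebra K V :=
  TensorAlgebra.lift K (x.constr K fun j => a j • gen x j)

/-- `y ↦ χ(α_i, deg y) y`. In terms of the braiding, `c (x_i ⊗ y) = twistL x Q i y ⊗ x_i`. -/
def twistL (x : Module.Basis ι K V) (Q : ι → ι → K) (i : ι) :
    TensorAlgebra K V →ₐ[K] TensorAlgebra K V :=
  diagHom x fun j => Q i j

/-- `y ↦ χ(deg y, α_i) y`. -/
def twistR (x : Module.Basis ι K V) (Q : ι → ι → K) (i : ι) :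
    TensorAlgebra K V →ₐ[K] TensorAlgebra K V :=
  diagHom x fun j => Q j i

/-- Left multiplication by `x_i ⊗ 1 + 1 ⊗ x_i` in the braided tensor product algebra
`T(V) ⊗ T(V)`, where `(1 ⊗ x_i) (a ⊗ b) = χ(α_i, deg a) a ⊗ x_i b`. -/
def braidedMulLeft (x : Module.Basis ι K V) (Q : ι → ι → K) (i : ι) :
    Module.End K (TensorAlgebra K V ⊗[K] TensorAlgebra K V) :=
  TensorProduct.map (LinearMap.mulLeft K (gen x i)) LinearMap.id +
    TensorProduct.map (twistL x Q i).toLinearMap (LinearMap.mulLeft K (gen x i))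

/-- The braided comultiplication `Δ : T(V) → T(V) ⊗ T(V)`: the algebra map into the braided tensor
product algebra with `Δ x_i = x_i ⊗ 1 + 1 ⊗ x_i`. It is determined by `Δ 1 = 1 ⊗ 1` and
`Δ (x_i y) = (x_i ⊗ 1 + 1 ⊗ x_i) Δ y`. -/
def comul (x : Module.Basis ι K V) (Q : ι → ι → K) :
    TensorAlgebra K V →ₗ[K] TensorAlgebra K V ⊗[K] TensorAlgebra K V :=
  (LinearMap.applyₗ (1 ⊗ₜ[K] 1)).comp
    (TensorAlgebra.lift K (x.constr K (braidedMulLeft x Q))).toLinearMap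

/-- `I` is a two-sided ideal and a coideal of `T(V)` contained in `⊕_{k ≥ 2} V^{⊗ k}`. -/
structure IsBiideal (x : Module.Basis ι K V) (Q : ι → ι → K)
    (I : Submodule K (TensorAlgebra K V)) : Prop where
  mul_left : ∀ a, ∀ b ∈ I, a * b ∈ I
  mul_right : ∀ a, ∀ b ∈ I, b * a ∈ I
  le_deg : I ≤ ⨆ (k : ℕ) (_ : 2 ≤ k),
    (LinearMap.range (TensorAlgebra.ι K : V →ₗ[K] TensorAlgebra K V)) ^ k
  coideal : ∀ a ∈ I, comul x Q a ∈
    LinearMap.range (TensorProduct.map I.subtype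
        (LinearMap.id : TensorAlgebra K V →ₗ[K] TensorAlgebra K V)) ⊔
      LinearMap.range (TensorProduct.map
        (LinearMap.id : TensorAlgebra K V →ₗ[K] TensorAlgebra K V) I.subtype)

/-- The largest ideal and coideal of `T(V)` in degrees at least two. -/
def nicholsIdeal (x : Module.Basis ι K V) (Q : ι → ι → K) : Submodule K (TensorAlgebra K V) :=
  sSup {I | IsBiideal x Q I}

/-- The Nichols algebra `B(V)`. -/
abbrev NicholsAlgebra (x : Module.Basis ι K V) (Q : ι → ι → K) :=
  RingQuot fun a b : TensorAlgebra K V => a - b ∈ nicholsIdeal x Q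

/-- The canonical map `π : T(V) → B(V)`. -/
def nicholsPi (x : Module.Basis ι K V) (Q : ι → ι → K) :
    TensorAlgebra K V →ₐ[K] NicholsAlgebra x Q :=
  RingQuot.mkAlgHom K _

/-- The algebra map `y ↦ (χ(deg y, α_i) y, d_i y; 0, y)` into upper triangular matrices; its
multiplicativity is the skew Leibniz rule. -/
def skewDerHom (x : Module.Basis ι K V) (Q : ι → ι → K) (i : ι) :
    TensorAlgebra K V →ₐ[K] Matrix (Fin 2) (Fin 2) (TensorAlgebra K V) :=
  TensorAlgebra.lift K (x.constr K fun j =>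
    !![Q j i • gen x j, algebraMap K (TensorAlgebra K V) (x.coord i (x j)); 0, gen x j])

/-- The skew-derivation `d_i` of `T(V)`:
`d_i x_j = δ_ij`, `d_i (y z) = d_i(y) z + χ(deg y, α_i) y d_i(z)`. -/
def skewDer (x : Module.Basis ι K V) (Q : ι → ι → K) (i : ι) :
    TensorAlgebra K V →ₗ[K] TensorAlgebra K V :=
  (Matrix.entryLinearMap K (TensorAlgebra K V) 0 1).comp (skewDerHom x Q i).toLinearMap

/-- The adjoint action of `x_i`: `(ad x_i)(y) = x_i y - χ(α_i, deg y) y x_i`. -/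
def adGen (x : Module.Basis ι K V) (Q : ι → ι → K) (i : ι) :
    Module.End K (TensorAlgebra K V) :=
  LinearMap.mulLeft K (gen x i) -
    (LinearMap.mulRight K (gen x i)).comp (twistL x Q i).toLinearMap

theorem diagHom_gen (x : Module.Basis ι K V) (a : ι → K) (j : ι) :
    diagHom x a (gen x j) = a j • gen x j := by
  simp [diagHom, gen]

theorem skewDer_gen [DecidableEq ι] (x : Module.Basis ι K V) (Q : ι → ι → K) (i j : ι) :
    skewDer x Q i (gen x j) = if i = j then 1 else 0 := by
  by_cases h : i = j
  · simp [skewDer, skewDerHom, gen, h]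
  · simp [skewDer, skewDerHom, gen, h, Finsupp.single_apply, Ne.symm h]

theorem skewDerHom_entries (x : Module.Basis ι K V) (Q : ι → ι → K) (i : ι)
    (y : TensorAlgebra K V) :
    skewDerHom x Q i y 0 0 = twistR x Q i y ∧ skewDerHom x Q i y 1 0 = 0 ∧
      skewDerHom x Q i y 1 1 = y := by
  induction y using TensorAlgebra.induction with
  | algebraMap r => simp [Matrix.algebraMap_matrix_apply]
  | ι v =>
    induction x.mem_span v using Submodule.span_induction with
    | zero => simp
    | mem v hv =>
      obtain ⟨j, rfl⟩ := hv
      simp [skewDerHom, twistR, diagHom, gen]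
    | add v w _ _ hv hw => simp [hv, hw]
    | smul a v _ hv => simp [hv]
  | mul a b ha hb => simp [Matrix.mul_apply, ha, hb]
  | add a b ha hb => simp [ha, hb]

theorem skewDer_mul (x : Module.Basis ι K V) (Q : ι → ι → K) (i : ι)
    (y z : TensorAlgebra K V) :
    skewDer x Q i (y * z) = skewDer x Q i y * z + twistR x Q i y * skewDer x Q i z := by
  have hy := skewDerHom_entries x Q i y
  have hz := skewDerHom_entries x Q i z
  simp [skewDer, Matrix.mul_apply, hy, hz, add_comm]

theorem comul_one (x : Module.Basis ι K V) (Q : ι → ι → K) :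
    comul x Q 1 = 1 ⊗ₜ[K] 1 := by
  simp [comul]

theorem comul_gen_mul (x : Module.Basis ι K V) (Q : ι → ι → K) (i : ι)
    (y : TensorAlgebra K V) :
    comul x Q (gen x i * y) = braidedMulLeft x Q i (comul x Q y) := by
  simp [comul, gen]

end General

/-! ### Quantum integers -/

section Scalars

variable {K : Type u} [Field K]

/-- `(k)_q = 1 + q + ⋯ + q^(k-1)`. -/
def qNum (q : K) (k : ℕ) : K := ∑ i ∈ Finset.range k, q ^ i

/-- `(k)_q^! = (1)_q (2)_q ⋯ (k)_q`. -/
def qFact (q : K) (k : ℕ) : K := ∏ i ∈ Finset.range k, qNum q (i + 1)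

/-- `b_k = ∏_{j=0}^{k-1} (1 - q^j r)`. -/
def bProd (q r : K) (k : ℕ) : K := ∏ j ∈ Finset.range k, (1 - q ^ j * r)

/-- Membership in the set `J`, by recursion: `j ∈ J` if and only if `q^(j(j-1)/2) (-r)^j s = -1`
and, for all `n ∈ J` with `n < j`, `((j-n)/2)_{q^(n+j-1) r^2} = 0` if `j - n` is even and
`(j-n)_{-q^((n+j-1)/2) r} = 0` if `j - n` is odd. -/
def MemJ (q r s : K) (j : ℕ) : Prop :=
  q ^ (j * (j - 1) / 2) * (-r) ^ j * s = -1 ∧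
    ∀ n, ∀ _ : n < j, MemJ q r s n →
      (Even (j - n) → qNum (q ^ (n + j - 1) * r ^ 2) ((j - n) / 2) = 0) ∧
      (Odd (j - n) → qNum (-(q ^ ((n + j - 1) / 2) * r)) (j - n) = 0)
termination_by j

/-- The set `J`. -/
def setJ (q r s : K) : Set ℕ := {j | MemJ q r s j}

theorem mem_setJ_iff (q r s : K) (j : ℕ) :
    j ∈ setJ q r s ↔ q ^ (j * (j - 1) / 2) * (-r) ^ j * s = -1 ∧
      ∀ n ∈ setJ q r s, n < j →
        (Even (j - n) → qNum (q ^ (n + j - 1) * r ^ 2) ((j - n) / 2) = 0) ∧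
        (Odd (j - n) → qNum (-(q ^ ((n + j - 1) / 2) * r)) (j - n) = 0) := by
  simp only [setJ, Set.mem_ofPred_eq]
  rw [MemJ]
  exact and_congr_right fun _ => ⟨fun h n hn hl => h n hl hn, fun h n hl hn => h n hn hl⟩

/-- The subset `J₁` of `J`. -/
def setJ1 (q r s : K) : Set ℕ :=
  {j | j ∈ setJ q r s ∧ q ^ (j * (j - 1) / 2) * (-r) ^ j * s = -1 ∧
    ∀ n ∈ setJ q r s, n < j → q ^ (n + j - 1) * r ^ 2 ≠ 1}

/-- The subset `J₂` of `J`; `ringChar K` is the characteristic of `K`. -/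
def setJ2 (q r s : K) : Set ℕ :=
  {j | j ∈ setJ q r s ∧ ∃ n ∈ setJ q r s, n < j ∧
    (Even (j - n) → q ^ (n + j - 1) * r ^ 2 = 1 ∧ 2 * ringChar K ∣ j - n) ∧
    (Odd (j - n) → q ^ ((n + j - 1) / 2) * r = -1 ∧ ringChar K ∣ j - n)}

end Scalars

/-! ### Rank two

The basis `x_1, x_2` is indexed by `0, 1 : Fin 2`. -/

section RankTwo

variable {K : Type u} [Field K] {V : Type v} [AddCommGroup V] [Module K V]

/-- `u_0 = x_2` and `u_{k+1} = x_1 u_k - q^k q_{12} u_k x_1`. -/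
def uElt (x : Module.Basis (Fin 2) K V) (Q : Fin 2 → Fin 2 → K) : ℕ → TensorAlgebra K V
  | 0 => gen x 1
  | k + 1 => gen x 0 * uElt x Q k - (Q 0 0 ^ k * Q 0 1) • (uElt x Q k * gen x 0)

open Classical in
/-- The normalized `u_k`, set to zero if `(k)_q^! b_k = 0`. -/
def uHat (x : Module.Basis (Fin 2) K V) (Q : Fin 2 → Fin 2 → K) (k : ℕ) : TensorAlgebra K V :=
  if qFact (Q 0 0) k * bProd (Q 0 0) (Q 0 1 * Q 1 0) k ≠ 0 then
    (qFact (Q 0 0) k * bProd (Q 0 0) (Q 0 1 * Q 1 0) k)⁻¹ • uElt x Q k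
  else 0

/-- `P_k = ∑_{i=0}^k (-q_{21})^i q^{i(i-1)/2} û_i û_{k-i}`. -/
def pElt (x : Module.Basis (Fin 2) K V) (Q : Fin 2 → Fin 2 → K) (k : ℕ) : TensorAlgebra K V :=
  ∑ i ∈ Finset.range (k + 1),
    ((-Q 1 0) ^ i * Q 0 0 ^ (i * (i - 1) / 2)) • (uHat x Q i * uHat x Q (k - i))

/-- `U_n`, spanned by `u_i u_{n-i}` with `0 ≤ i ≤ n`. -/
def uSpace (x : Module.Basis (Fin 2) K V) (Q : Fin 2 → Fin 2 → K) (n : ℕ) :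
    Submodule K (TensorAlgebra K V) :=
  Submodule.span K {y | ∃ i, i ≤ n ∧ y = uElt x Q i * uElt x Q (n - i)}

/-- `U'_n`, spanned by `u_i u_{n-i}` with `0 ≤ i ≤ n - 1`. -/
def uSpace' (x : Module.Basis (Fin 2) K V) (Q : Fin 2 → Fin 2 → K) (n : ℕ) :
    Submodule K (TensorAlgebra K V) :=
  Submodule.span K {y | ∃ i, i < n ∧ y = uElt x Q i * uElt x Q (n - i)}

/-- The kernel of `π : T(V) → B(V)`. -/
def kerPi (x : Module.Basis (Fin 2) K V) (Q : Fin 2 → Fin 2 → K) :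
    Submodule K (TensorAlgebra K V) :=
  LinearMap.ker (nicholsPi x Q).toLinearMap

/-- The set `J₁` for `q = q_{11}`, `r = q_{12} q_{21}`, `s = q_{22}`. -/
def J1 (Q : Fin 2 → Fin 2 → K) : Set ℕ := setJ1 (Q 0 0) (Q 0 1 * Q 1 0) (Q 1 1)

/-- The set `J₂` for `q = q_{11}`, `r = q_{12} q_{21}`, `s = q_{22}`. -/
def J2 (Q : Fin 2 → Fin 2 → K) : Set ℕ := setJ2 (Q 0 0) (Q 0 1 * Q 1 0) (Q 1 1)

/-- `j` is the index `j_n` attached to `n`: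
`j ∈ J₁`, `j < n` and `q^(n+j-1) r^2 = 1`. -/
def IsIndexFor (Q : Fin 2 → Fin 2 → K) (n j : ℕ) : Prop :=
  j ∈ J1 Q ∧ j < n ∧ Q 0 0 ^ (n + j - 1) * (Q 0 1 * Q 1 0) ^ 2 = 1

/-- `L` is the element `L_n`, given `j = j_n`: it lies in `U'_n ∩ ker π` and satisfies
`-q_{21}^{-1} d_1(L) = (ad x_1)^{n-j-1}(P_j)`. -/
def IsLElt (x : Module.Basis (Fin 2) K V) (Q : Fin 2 → Fin 2 → K) (n j : ℕ)
    (L : TensorAlgebra K V) : Prop :=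
  L ∈ uSpace' x Q n ⊓ kerPi x Q ∧
    (-(Q 1 0)⁻¹) • skewDer x Q 0 L = (adGen x Q 0 ^ (n - j - 1)) (pElt x Q j)

/-- The elements `(ad x_1)^{m-j}(P_j)` for `j ∈ J₁ ∩ [0,m]` together with
`(ad x_1)^{m-n}(L_n)` for `n ∈ J₂ ∩ [0,m]`, as one family. -/
def relFamily (x : Module.Basis (Fin 2) K V) (Q : Fin 2 → Fin 2 → K) (m : ℕ)
    (L : ℕ → TensorAlgebra K V) :
    {j : ℕ // j ∈ J1 Q ∧ j ≤ m} ⊕ {n : ℕ // n ∈ J2 Q ∧ n ≤ m} → TensorAlgebra K V :=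
  Sum.elim (fun j => (adGen x Q 0 ^ (m - j.1)) (pElt x Q j.1))
    (fun n => (adGen x Q 0 ^ (m - n.1)) (L n.1))

end RankTwo

end NicholsDiag

end

open NicholsDiag

/-! Membership in $\ker\pi$ is reduced to skew-derivations. Let $I$ be the set of elements killed by
$\varepsilon d_{i_k}\cdots d_{i_1}$ for every word, $\varepsilon$ being the augmentation. Since
$d_i\otimes\mathrm{id}$ commutes with the comultiplication, $I$ is a biideal in degrees at least two
(`isBiideal_vanishing`), so $I\subseteq\ker\pi$. Only this inclusion is needed.

In $U_n$, an element $\sum_i c_i(-q_{21})^iq^{i(i-1)/2}\hat u_i\hat u_{n-i}$ is encoded by its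
sequence $c$. Then $d_1$ becomes the weighted difference $-q_{21}q^i(c_{i+1}-c_i)$, `adSeq`
describes $\mathrm{ad}\,x_1$, and $d_2$ sees only $c_0$ and $c_n$. The element $P_n$ is the constant
sequence $1$: it is killed by $d_1$, and by $d_2$ when $q^{n(n-1)/2}(-r)^ns=-1$.

Constructing $L_n$ means summing a difference equation whose right-hand side comes from
$(\mathrm{ad}\,x_1)^{n-j-1}(P_j)$. A solution with $c_0=c_n=0$ exists if the total sum vanishes
(`sum_pow_adIter_eq_zero`). That sum telescopes only after multiplication by $1-q^{n+j-1}r^2$, which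
is zero here; so the identity is proved with $r$ an indeterminate, the factor is cancelled, and the
quantum integer from the definition of $J$ remains. The solution is unique because $d_1$ is
injective on $U'_n$.

Linear independence is by induction on $m$, applying $d_1$ to a relation
(`coeff_eq_zero_of_sum_eq_zero`). The obstruction is the vanishing of $1-q^{m+n}r^2$ for several
indices $n$. Two coincidences $q^ar^2=q^br^2=1$ with $0<|a-b|\le m$ force $q=1$. That is impossible
if $J_2\cap[0,m]$ is nonempty, for then some positive integer at most $m$ is zero in $K$, against
$(m)_q^!\ne0$; among indices in $J_1$ it contradicts the definition of $J_1$. -/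

noncomputable section

namespace NicholsDiag

universe u v w

/-! ### Skew-derivations and a biideal contained in the kernel of $\pi$ -/

section VanishingIdeal

variable {K : Type u} [Field K] {V : Type v} [AddCommGroup V] [Module K V] {ι : Type w}

/-- Induction on the tensor algebra by left multiplication with generators. -/
theorem gen_mul_induction (x : Module.Basis ι K V) {p : TensorAlgebra K V → Prop}
    (one : p 1) (gen_mul : ∀ i y, p y → p (gen x i * y))
    (add : ∀ y z, p y → p z → p (y + z)) (smul : ∀ (a : K) y, p y → p (a • y))
    (y : TensorAlgebra K V) : p y := by
  suffices h : ∀ z, p z → p (y * z) by simpa using h 1 one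
  induction y using TensorAlgebra.induction with
  | algebraMap r => intro z hz; rw [← Algebra.smul_def]; exact smul r z hz
  | ι v =>
    intro z hz
    induction x.mem_span v using Submodule.span_induction with
    | zero => simpa using smul 0 z hz
    | mem v hv =>
      obtain ⟨j, rfl⟩ := hv
      exact gen_mul j z hz
    | add v w _ _ hv hw => rw [map_add, add_mul]; exact add _ _ hv hw
    | smul a v _ hv => rw [map_smul, smul_mul_assoc]; exact smul a _ hv
  | mul a b ha hb => intro z hz; rw [mul_assoc]; exact ha _ (hb _ hz)
  | add a b ha hb => intro z hz; rw [add_mul]; exact add _ _ (ha _ hz) (hb _ hz)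

/-- The augmentation of the tensor algebra. -/
abbrev aug : TensorAlgebra K V →ₐ[K] K := TensorAlgebra.algebraMapInv

theorem aug_gen (x : Module.Basis ι K V) (i : ι) : aug (gen x i) = 0 := by
  simp [aug, gen, TensorAlgebra.algebraMapInv]

theorem skewDer_one (x : Module.Basis ι K V) (Q : ι → ι → K) (i : ι) :
    skewDer x Q i 1 = 0 := by
  simp [skewDer]

theorem twistR_gen (x : Module.Basis ι K V) (Q : ι → ι → K) (i j : ι) :
    twistR x Q i (gen x j) = Q j i • gen x j := diagHom_gen x _ j

theorem twistL_gen (x : Module.Basis ι K V) (Q : ι → ι → K) (i j : ι) :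
    twistL x Q i (gen x j) = Q i j • gen x j := diagHom_gen x _ j

theorem skewDer_gen_mul [DecidableEq ι] (x : Module.Basis ι K V) (Q : ι → ι → K) (i j : ι)
    (y : TensorAlgebra K V) :
    skewDer x Q i (gen x j * y) =
      (if i = j then y else 0) + Q j i • (gen x j * skewDer x Q i y) := by
  rw [skewDer_mul, skewDer_gen, twistR_gen, smul_mul_assoc]
  split_ifs <;> simp

theorem skewDer_diagHom [DecidableEq ι] (x : Module.Basis ι K V) (Q : ι → ι → K) (a : ι → K)
    (i : ι) (y : TensorAlgebra K V) :
    skewDer x Q i (diagHom x a y) = a i • diagHom x a (skewDer x Q i y) := by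
  induction y using gen_mul_induction x with
  | one => simp [skewDer_one]
  | gen_mul j y hy =>
    rw [map_mul, diagHom_gen, smul_mul_assoc, map_smul, skewDer_gen_mul, hy, skewDer_gen_mul]
    split_ifs with h
    · subst h
      simp only [map_add, map_smul, map_mul, diagHom_gen, smul_add, smul_mul_assoc,
        mul_smul_comm, smul_smul]
    · simp only [map_smul, map_mul, diagHom_gen, smul_mul_assoc, mul_smul_comm, smul_smul,
        zero_add]
      congr 1; ring
  | add y z hy hz => simp only [map_add, hy, hz, smul_add]
  | smul c y hy => simp only [map_smul, hy, smul_comm c]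

theorem aug_diagHom (x : Module.Basis ι K V) (a : ι → K) (y : TensorAlgebra K V) :
    aug (diagHom x a y) = aug y := by
  induction y using gen_mul_induction x with
  | one => simp
  | gen_mul j y hy => simp [diagHom_gen, aug_gen]
  | add y z hy hz => simp only [map_add, hy, hz]
  | smul c y hy => simp only [map_smul, hy]

/-- The iterated skew-derivation along a word; its first letter is applied first. -/
def iterDer (x : Module.Basis ι K V) (Q : ι → ι → K) :
    List ι → TensorAlgebra K V →ₗ[K] TensorAlgebra K V
  | [] => LinearMap.id
  | i :: w => (iterDer x Q w).comp (skewDer x Q i)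

/-- The functional `y ↦ ε (d_w y)`. -/
def wordFun (x : Module.Basis ι K V) (Q : ι → ι → K) (w : List ι) :
    TensorAlgebra K V →ₗ[K] K :=
  aug.toLinearMap.comp (iterDer x Q w)

/-- The elements killed by all `ε d_w`. -/
def vanishing (x : Module.Basis ι K V) (Q : ι → ι → K) : Submodule K (TensorAlgebra K V) :=
  ⨅ w, LinearMap.ker (wordFun x Q w)

theorem mem_vanishing {x : Module.Basis ι K V} {Q : ι → ι → K} {y : TensorAlgebra K V} :
    y ∈ vanishing x Q ↔ ∀ w, wordFun x Q w y = 0 := by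
  simp [vanishing]

theorem wordFun_nil (x : Module.Basis ι K V) (Q : ι → ι → K) (y : TensorAlgebra K V) :
    wordFun x Q [] y = aug y := rfl

theorem wordFun_cons (x : Module.Basis ι K V) (Q : ι → ι → K) (i : ι) (w : List ι)
    (y : TensorAlgebra K V) : wordFun x Q (i :: w) y = wordFun x Q w (skewDer x Q i y) := rfl

theorem mem_vanishing_iff {x : Module.Basis ι K V} {Q : ι → ι → K} {y : TensorAlgebra K V} :
    y ∈ vanishing x Q ↔ aug y = 0 ∧ ∀ i, skewDer x Q i y ∈ vanishing x Q := by
  simp only [mem_vanishing]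
  constructor
  · exact fun h => ⟨h [], fun i w => h (i :: w)⟩
  · rintro ⟨h0, h1⟩ (_ | ⟨i, w⟩)
    · exact h0
    · exact h1 i w

theorem diagHom_mem_vanishing [DecidableEq ι] {x : Module.Basis ι K V} {Q : ι → ι → K}
    (a : ι → K) {y : TensorAlgebra K V} (hy : y ∈ vanishing x Q) :
    diagHom x a y ∈ vanishing x Q := by
  rw [mem_vanishing]
  intro w
  induction w generalizing y with
  | nil => rw [wordFun_nil, aug_diagHom]; exact (mem_vanishing_iff.1 hy).1
  | cons i w ih =>
    rw [wordFun_cons, skewDer_diagHom, map_smul, ih ((mem_vanishing_iff.1 hy).2 i), smul_zero]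

/-- Induction on the word with the multiplier left free: the skew Leibniz rule changes the
multiplier but leaves a shorter word and another element of the same subspace. -/
theorem mul_mem_vanishing_left [DecidableEq ι] {x : Module.Basis ι K V} {Q : ι → ι → K}
    (a : TensorAlgebra K V) {y : TensorAlgebra K V} (hy : y ∈ vanishing x Q) :
    a * y ∈ vanishing x Q := by
  rw [mem_vanishing]
  intro w
  induction w generalizing y a with
  | nil => rw [wordFun_nil, map_mul, (mem_vanishing_iff.1 hy).1, mul_zero]
  | cons i w ih =>
    rw [wordFun_cons, skewDer_mul, map_add, ih _ hy, ih _ ((mem_vanishing_iff.1 hy).2 i), add_zero]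

theorem mul_mem_vanishing_right [DecidableEq ι] {x : Module.Basis ι K V} {Q : ι → ι → K}
    (a : TensorAlgebra K V) {y : TensorAlgebra K V} (hy : y ∈ vanishing x Q) :
    y * a ∈ vanishing x Q := by
  rw [mem_vanishing]
  intro w
  induction w generalizing y a with
  | nil => rw [wordFun_nil, map_mul, (mem_vanishing_iff.1 hy).1, zero_mul]
  | cons i w ih =>
    rw [wordFun_cons, skewDer_mul, map_add, ih _ ((mem_vanishing_iff.1 hy).2 i),
      zero_add]
    exact ih _ (diagHom_mem_vanishing _ hy)

theorem gen_mem_range (x : Module.Basis ι K V) (i : ι) :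
    gen x i ∈ LinearMap.range (TensorAlgebra.ι K : V →ₗ[K] TensorAlgebra K V) :=
  LinearMap.mem_range_self _ _

theorem gen_mul_mem_iSup (x : Module.Basis ι K V) (i : ι) {z : TensorAlgebra K V}
    (hz : z ∈ ⨆ (k : ℕ) (_ : 2 ≤ k),
      (LinearMap.range (TensorAlgebra.ι K : V →ₗ[K] TensorAlgebra K V)) ^ k) :
    gen x i * z ∈ ⨆ (k : ℕ) (_ : 2 ≤ k),
      (LinearMap.range (TensorAlgebra.ι K : V →ₗ[K] TensorAlgebra K V)) ^ k := by
  have h := Submodule.mul_mem_mul (gen_mem_range x i) hz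
  rw [Submodule.mul_iSup] at h
  refine Set.mem_of_subset_of_mem (SetLike.coe_subset_coe.2 (iSup_le fun k => ?_)) h
  rw [Submodule.mul_iSup]
  refine iSup_le fun hk => ?_
  rw [← pow_succ']
  exact le_iSup₂_of_le (k + 1) (by omega) le_rfl

/-- The words of length zero and one recover the components of degree zero and one. This yields the
degree condition for a biideal. -/
theorem sub_low_degree_mem [Fintype ι] [DecidableEq ι] (x : Module.Basis ι K V) (Q : ι → ι → K)
    (y : TensorAlgebra K V) :
    y - algebraMap K _ (aug y) - ∑ i, aug (skewDer x Q i y) • gen x i ∈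
      ⨆ (k : ℕ) (_ : 2 ≤ k),
        (LinearMap.range (TensorAlgebra.ι K : V →ₗ[K] TensorAlgebra K V)) ^ k := by
  induction y using gen_mul_induction x with
  | one => simp [skewDer_one]
  | gen_mul j y hy =>
    have h1 := gen_mul_mem_iSup x j hy
    have h2 : ∑ i, aug (skewDer x Q i y) • (gen x j * gen x i) ∈ ⨆ (k : ℕ) (_ : 2 ≤ k),
        (LinearMap.range (TensorAlgebra.ι K : V →ₗ[K] TensorAlgebra K V)) ^ k := by
      refine Submodule.sum_mem _ fun i _ => Submodule.smul_mem _ _ ?_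
      refine Submodule.mem_iSup_of_mem 2 (Submodule.mem_iSup_of_mem le_rfl ?_)
      rw [pow_two]
      exact Submodule.mul_mem_mul (gen_mem_range x j) (gen_mem_range x i)
    convert Submodule.add_mem _ h1 h2 using 1
    have h3 : ∑ i, aug (skewDer x Q i (gen x j * y)) • gen x i = aug y • gen x j := by
      rw [Finset.sum_eq_single j]
      · simp [skewDer_gen_mul, aug_gen]
      · intro b _ hb; simp [skewDer_gen_mul, aug_gen, hb]
      · simp
    rw [h3]
    simp only [mul_sub, Finset.mul_sum, mul_smul_comm, map_mul, aug_gen, zero_mul, map_zero,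
      sub_zero, sub_add_cancel]
    rw [← Algebra.commutes, ← Algebra.smul_def]
  | add y z hy hz =>
    convert Submodule.add_mem _ hy hz using 1
    simp only [map_add, add_smul, Finset.sum_add_distrib]
    abel
  | smul c y hy =>
    convert Submodule.smul_mem _ c hy using 1
    simp only [map_smul, smul_sub, Finset.smul_sum, smul_smul, smul_eq_mul, map_mul]
    rw [← Algebra.smul_def]

theorem skewDer_comul [DecidableEq ι] (x : Module.Basis ι K V) (Q : ι → ι → K) (i : ι)
    (y : TensorAlgebra K V) :
    TensorProduct.map (skewDer x Q i) LinearMap.id (comul x Q y) =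
      comul x Q (skewDer x Q i y) := by
  have key : ∀ (j : ι) (t : TensorAlgebra K V ⊗[K] TensorAlgebra K V),
      TensorProduct.map (skewDer x Q i) LinearMap.id (braidedMulLeft x Q j t) =
        (if i = j then t else 0) +
          Q j i • braidedMulLeft x Q j (TensorProduct.map (skewDer x Q i) LinearMap.id t) := by
    intro j t
    induction t using TensorProduct.induction_on with
    | zero => simp
    | tmul a b =>
      have h := skewDer_diagHom x Q (fun k => Q j k) i a
      simp only [braidedMulLeft, LinearMap.add_apply, TensorProduct.map_tmul,
        LinearMap.mulLeft_apply, LinearMap.id_apply, map_add, skewDer_gen_mul,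
        AlgHom.toLinearMap_apply, twistL, h, TensorProduct.add_tmul, smul_add,
        TensorProduct.smul_tmul']
      split_ifs <;> simp [add_assoc]
    | add a b ha hb =>
      simp only [map_add, ha, hb, smul_add]
      split_ifs
      · abel
      · abel
  induction y using gen_mul_induction x with
  | one => simp [skewDer_one, comul_one]
  | gen_mul j y hy =>
    rw [comul_gen_mul, key, hy, skewDer_gen_mul, map_add, map_smul, comul_gen_mul]
    split_ifs <;> simp
  | add y z hy hz => simp only [map_add, hy, hz]
  | smul c y hy => simp only [map_smul, hy]

theorem aug_comul (x : Module.Basis ι K V) (Q : ι → ι → K) (y : TensorAlgebra K V) :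
    TensorProduct.map aug.toLinearMap LinearMap.id (comul x Q y) = (1 : K) ⊗ₜ[K] y := by
  have key : ∀ (j : ι) (t : TensorAlgebra K V ⊗[K] TensorAlgebra K V),
      TensorProduct.map aug.toLinearMap LinearMap.id (braidedMulLeft x Q j t) =
        TensorProduct.map LinearMap.id (LinearMap.mulLeft K (gen x j))
          (TensorProduct.map aug.toLinearMap LinearMap.id t) := by
    intro j t
    induction t using TensorProduct.induction_on with
    | zero => simp
    | tmul a b => simp [braidedMulLeft, aug_gen, twistL, aug_diagHom]
    | add a b ha hb => simp only [map_add, ha, hb]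
  induction y using gen_mul_induction x with
  | one => simp [comul_one]
  | gen_mul j y hy => rw [comul_gen_mul, key, hy]; simp
  | add y z hy hz => simp only [map_add, hy, hz, TensorProduct.tmul_add]
  | smul c y hy => simp only [map_smul, hy, TensorProduct.tmul_smul]

/-- Pairing the left tensor factor with a word functional amounts to differentiating, so a pair of
word functionals evaluated on $\Delta y$ is the functional of the concatenated word on $y$. -/
theorem wordFun_comul [DecidableEq ι] (x : Module.Basis ι K V) (Q : ι → ι → K) (w : List ι)
    (y : TensorAlgebra K V) :
    TensorProduct.map (wordFun x Q w) LinearMap.id (comul x Q y) =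
      (1 : K) ⊗ₜ[K] iterDer x Q w y := by
  induction w generalizing y with
  | nil => exact aug_comul x Q y
  | cons i w ih =>
    have h : wordFun x Q (i :: w) = (wordFun x Q w).comp (skewDer x Q i) := rfl
    rw [h, ← LinearMap.id_comp (LinearMap.id : TensorAlgebra K V →ₗ[K] _), TensorProduct.map_comp,
      LinearMap.comp_apply, skewDer_comul, ih]
    rfl

/-- Tensors are separated by products of separating families of functionals. -/
theorem tensor_eq_zero_of_separating {A B : Type*} [AddCommGroup A] [Module K A]
    [AddCommGroup B] [Module K B] {α β : Type*} (f : α → A →ₗ[K] K) (g : β → B →ₗ[K] K)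
    (hf : ∀ a, (∀ i, f i a = 0) → a = 0) (hg : ∀ b, (∀ i, g i b = 0) → b = 0)
    (t : A ⊗[K] B) (ht : ∀ i j, TensorProduct.map (f i) (g j) t = 0) : t = 0 := by
  classical
  let e := Module.Basis.ofVectorSpace K B
  have hrep : ∀ i k, f i (TensorProduct.equivFinsuppOfBasisRight (M := A) e t k) = 0 := by
    intro i k
    have h1 : ∀ t : A ⊗[K] B, ∀ k, f i (TensorProduct.equivFinsuppOfBasisRight (M := A) e t k) =
        e.repr (TensorProduct.lid K B (TensorProduct.map (f i) LinearMap.id t)) k := by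
      intro t k
      induction t using TensorProduct.induction_on with
      | zero => simp
      | tmul a b => simp [mul_comm]
      | add a b ha hb => simp only [map_add, Finsupp.add_apply, ha, hb]
    rw [h1]
    have h2 : TensorProduct.lid K B (TensorProduct.map (f i) LinearMap.id t) = 0 := by
      refine hg _ fun j => ?_
      have h3 : ∀ t : A ⊗[K] B, g j (TensorProduct.lid K B (TensorProduct.map (f i)
          LinearMap.id t)) = TensorProduct.lid K K (TensorProduct.map (f i) (g j) t) := by
        intro t
        induction t using TensorProduct.induction_on with
        | zero => simp
        | tmul a b => simp
        | add a b ha hb => simp only [map_add, ha, hb]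
      rw [h3, ht, map_zero]
    rw [h2, map_zero, Finsupp.zero_apply]
  refine (TensorProduct.equivFinsuppOfBasisRight (M := A) e).injective ?_
  rw [map_zero]
  ext k
  exact hf _ fun i => hrep i k

/-- The target is the kernel of $T\otimes T\to T/I\otimes T/I$. The word functionals descend to
$T/I$ and separate its points, so testing $\Delta y$ against pairs of words suffices. -/
theorem comul_mem_of_mem_vanishing [DecidableEq ι] {x : Module.Basis ι K V} {Q : ι → ι → K}
    {y : TensorAlgebra K V} (hy : y ∈ vanishing x Q) :
    comul x Q y ∈
      LinearMap.range (TensorProduct.map (vanishing x Q).subtype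
          (LinearMap.id : TensorAlgebra K V →ₗ[K] TensorAlgebra K V)) ⊔
        LinearMap.range (TensorProduct.map
          (LinearMap.id : TensorAlgebra K V →ₗ[K] TensorAlgebra K V) (vanishing x Q).subtype) := by
  set I := vanishing x Q with hI
  have hker := TensorProduct.map_ker (g := I.mkQ) (g' := I.mkQ) (f := I.subtype)
    (f' := I.subtype) (by rw [LinearMap.exact_iff]; simp) I.mkQ_surjective
    (by rw [LinearMap.exact_iff]; simp) I.mkQ_surjective
  rw [sup_comm]
  change _ ∈ LinearMap.range (LinearMap.lTensor _ I.subtype) ⊔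
    LinearMap.range (LinearMap.rTensor _ I.subtype)
  rw [← hker, LinearMap.mem_ker]
  have hle : ∀ w, I ≤ LinearMap.ker (wordFun x Q w) := fun w => iInf_le _ w
  have hsep : ∀ a : TensorAlgebra K V ⧸ I, (∀ w, I.liftQ _ (hle w) a = 0) → a = 0 := by
    intro a ha
    obtain ⟨a, rfl⟩ := I.mkQ_surjective a
    rw [Submodule.mkQ_apply, Submodule.Quotient.mk_eq_zero]
    exact mem_vanishing.2 fun w => ha w
  refine tensor_eq_zero_of_separating _ _ hsep hsep _ fun w w' => ?_
  rw [← LinearMap.comp_apply, ← TensorProduct.map_comp, Submodule.liftQ_mkQ, Submodule.liftQ_mkQ]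
  have h : TensorProduct.map (wordFun x Q w) (wordFun x Q w') =
      (TensorProduct.map LinearMap.id (wordFun x Q w')).comp
        (TensorProduct.map (wordFun x Q w) LinearMap.id) := by
    rw [← TensorProduct.map_comp, LinearMap.id_comp, LinearMap.comp_id]
  rw [h, LinearMap.comp_apply, wordFun_comul, TensorProduct.map_tmul]
  have h0 : ∀ (w : List ι) (z : TensorAlgebra K V), z ∈ I → iterDer x Q w z ∈ I := by
    intro w
    induction w with
    | nil => exact fun z hz => hz
    | cons i w ih => exact fun z hz => ih _ ((mem_vanishing_iff.1 hz).2 i)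
  rw [mem_vanishing.1 (h0 w y hy) w', TensorProduct.tmul_zero]

theorem isBiideal_vanishing [Fintype ι] [DecidableEq ι] (x : Module.Basis ι K V)
    (Q : ι → ι → K) : IsBiideal x Q (vanishing x Q) where
  mul_left a _ hb := mul_mem_vanishing_left a hb
  mul_right a _ hb := mul_mem_vanishing_right a hb
  le_deg y hy := by
    have h := sub_low_degree_mem x Q y
    obtain ⟨h0, h1⟩ := mem_vanishing_iff.1 hy
    have h2 : ∀ i, aug (skewDer x Q i y) = 0 := fun i => (mem_vanishing_iff.1 (h1 i)).1
    simpa [h0, h2] using h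
  coideal _ hy := comul_mem_of_mem_vanishing hy

theorem nicholsPi_eq_zero_of_mem_vanishing [Fintype ι] [DecidableEq ι] {x : Module.Basis ι K V}
    {Q : ι → ι → K} {y : TensorAlgebra K V} (hy : y ∈ vanishing x Q) : nicholsPi x Q y = 0 := by
  have h : y - 0 ∈ nicholsIdeal x Q := by
    rw [sub_zero]
    exact (le_sSup (isBiideal_vanishing x Q) : vanishing x Q ≤ nicholsIdeal x Q) hy
  have := RingQuot.mkAlgHom_rel K (s := fun a b : TensorAlgebra K V => a - b ∈ nicholsIdeal x Q) h
  rwa [map_zero] at this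

end VanishingIdeal

/-! ### Coefficient sequences and the closed form of their weighted sum -/

section Sequences

variable {R : Type u} [CommRing R]

/-- `(k)_q (1 - q^(k-1) r)` over a commutative ring. -/
def qBeta (q r : R) (k : ℕ) : R := (∑ i ∈ Finset.range k, q ^ i) * (1 - q ^ (k - 1) * r)

theorem qBeta_zero (q r : R) : qBeta q r 0 = 0 := by simp [qBeta]

theorem qBeta_succ (q r : R) (k : ℕ) :
    qBeta q r (k + 1) = q * qBeta q r k + (1 - q ^ (2 * k) * r) := by
  cases k with
  | zero => simp [qBeta]
  | succ k =>
    have h1 := geom_sum_succ (x := q) (n := k + 1)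
    have h2 := geom_sum_succ' (x := q) (n := k + 1)
    simp only [qBeta, Nat.add_sub_cancel]
    linear_combination h1 - q ^ (k + 1) * r * h2

/-- The action of `-q₂₁ (ad x₁)` on normalized coefficient sequences of elements of `U_{M-1}`,
where `p = q⁻¹`. -/
def adSeq (q p r : R) (M : ℕ) (c : ℕ → R) (i : ℕ) : R :=
  qBeta q r i * p ^ (i - 1) * c (i - 1) - q ^ i * r * qBeta q r (M - i) * c i

/-- The out-of-range values, $c_{i-1}$ at $i=0$ and $c_i$ at $i=M$, are multiplied by `qBeta q r 0`,
which is zero. -/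
theorem adSeq_congr (q p r : R) (M : ℕ) {c c' : ℕ → R} (h : ∀ i < M, c i = c' i) {i : ℕ}
    (hi : i ≤ M) : adSeq q p r M c i = adSeq q p r M c' i := by
  unfold adSeq
  congr 1
  · rcases i with _ | i
    · simp [qBeta_zero]
    · rw [Nat.add_sub_cancel, h i (by omega)]
  · rcases hi.lt_or_eq with hi | rfl
    · rw [h i hi]
    · simp [qBeta_zero]

theorem adSeq_smul (q p r a : R) (M : ℕ) (c : ℕ → R) (i : ℕ) :
    adSeq q p r M (fun i => a * c i) i = a * adSeq q p r M c i := by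
  unfold adSeq; ring

/-- The commutation rule of $d_1$ with $\mathrm{ad}\,x_1$ on $U_N$, in coefficients. An explicit
inverse `p` over a commutative ring is used so that the rule also applies over $K[X]$. -/
theorem diff_adSeq {q p : R} (hqp : q * p = 1) (r : R) {N i : ℕ} (hi : i ≤ N) (c : ℕ → R) :
    q ^ i * (adSeq q p r (N + 1) c (i + 1) - adSeq q p r (N + 1) c i) =
      (1 - q ^ (2 * N) * r ^ 2) * c i +
        q * adSeq q p r N (fun i => q ^ i * (c (i + 1) - c i)) i := by
  obtain ⟨l, rfl⟩ := Nat.exists_eq_add_of_le hi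
  have e1 : i + l + 1 - (i + 1) = l := by omega
  have e2 : i + l + 1 - i = l + 1 := by omega
  have e3 : i + l - i = l := by omega
  have hp : ∀ k : ℕ, q ^ k * p ^ k = 1 := fun k => by rw [← mul_pow, hqp, one_pow]
  rcases i with _ | i
  · simp only [adSeq, e1, e2, e3, qBeta_zero, Nat.add_sub_cancel, pow_zero]
    rw [qBeta_succ q r l, qBeta_succ q r 0, qBeta_zero]
    simp only [zero_add, mul_zero, pow_zero]
    ring
  · simp only [adSeq, e1, e2, e3, Nat.add_sub_cancel]
    rw [qBeta_succ q r l, qBeta_succ q r (i + 1)]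
    have h1 := hp (i + 1)
    have h0 := hp i
    linear_combination (q * qBeta q r (i + 1) + 1 - q ^ (2 * (i + 1)) * r) * c (i + 1) * h1 -
      q * qBeta q r (i + 1) * c (i + 1) * h0

/-- The normalized coefficients of `(-q₂₁)^k (ad x₁)^k (P_j)`. -/
def adIter (q p r : R) (j : ℕ) : ℕ → ℕ → R
  | 0 => fun _ => 1
  | k + 1 => adSeq q p r (j + k + 1) (adIter q p r j k)

theorem diff_adIter {q p : R} (hqp : q * p = 1) (r : R) (j k : ℕ) {i : ℕ} (hi : i ≤ j + k) :
    q ^ i * (adIter q p r j (k + 1) (i + 1) - adIter q p r j (k + 1) i) =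
      (∑ t ∈ Finset.range (k + 1), q ^ t) * (1 - q ^ (2 * j + k) * r ^ 2) *
        adIter q p r j k i := by
  induction k generalizing i with
  | zero =>
    have h := diff_adSeq hqp r hi (adIter q p r j 0)
    simp only [adIter, sub_self, mul_zero] at h
    change _ * (adSeq q p r (j + 0 + 1) (fun _ => 1) (i + 1) -
      adSeq q p r (j + 0 + 1) (fun _ => 1) i) = _ * 1
    rw [h]
    simp [adSeq]
  | succ k ih =>
    rw [adIter, diff_adSeq hqp r hi]
    have h := adSeq_congr q p r (j + (k + 1)) (c := fun i =>
      q ^ i * (adIter q p r j (k + 1) (i + 1) - adIter q p r j (k + 1) i))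
      (fun i hi => ih (by omega : i ≤ j + k)) hi
    rw [h, adSeq_smul]
    change _ + q * (_ * adIter q p r j (k + 1) i) = _
    have h1 := geom_sum_succ (x := q) (n := k + 1)
    have h2 := geom_sum_succ' (x := q) (n := k + 1)
    linear_combination (adIter q p r j (k + 1) i * q ^ (2 * j + k + 1) * r ^ 2) * h2 -
      (adIter q p r j (k + 1) i) * h1

theorem adIter_zero_right (q p r : R) (j k : ℕ) :
    adIter q p r j k 0 = (-r) ^ k * ∏ t ∈ Finset.range k, qBeta q r (j + t + 1) := by
  induction k with
  | zero => simp [adIter]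
  | succ k ih =>
    rw [adIter, adSeq, ih, Finset.prod_range_succ, qBeta_zero, Nat.sub_zero]
    ring

theorem adIter_top (q p r : R) (j k : ℕ) :
    adIter q p r j k (j + k) =
      (∏ t ∈ Finset.range k, p ^ (j + t)) * ∏ t ∈ Finset.range k, qBeta q r (j + t + 1) := by
  induction k with
  | zero => simp [adIter]
  | succ k ih =>
    rw [adIter, adSeq, Finset.prod_range_succ, Finset.prod_range_succ]
    simp only [← add_assoc, Nat.sub_self, Nat.add_sub_cancel, qBeta_zero, ih]
    ring

/-- By `diff_adIter` the summands are differences of the next iterate, so the sum telescopes to its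
top minus its bottom coefficient; the product of powers of $q$ clears the powers of `p`. -/
theorem sum_pow_adIter {q p : R} (hqp : q * p = 1) (r : R) (j k : ℕ) :
    (∏ t ∈ Finset.range (k + 1), q ^ (j + t)) *
        ((∑ t ∈ Finset.range (k + 1), q ^ t) * (1 - q ^ (2 * j + k) * r ^ 2) *
          ∑ i ∈ Finset.range (j + k + 1), p ^ i * adIter q p r j k i) =
      (∏ t ∈ Finset.range (k + 1), qBeta q r (j + t + 1)) *
        (1 - ∏ t ∈ Finset.range (k + 1), (-(q ^ (j + t) * r))) := by
  have h1 : (∑ t ∈ Finset.range (k + 1), q ^ t) * (1 - q ^ (2 * j + k) * r ^ 2) *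
      ∑ i ∈ Finset.range (j + k + 1), p ^ i * adIter q p r j k i =
      adIter q p r j (k + 1) (j + (k + 1)) - adIter q p r j (k + 1) 0 := by
    rw [← add_assoc, ← Finset.sum_range_sub, Finset.mul_sum]
    refine Finset.sum_congr rfl fun i hi => ?_
    have h := diff_adIter hqp r j k (Nat.lt_succ_iff.1 (Finset.mem_range.1 hi))
    have hp : q ^ i * p ^ i = 1 := by rw [← mul_pow, hqp, one_pow]
    linear_combination (adIter q p r j (k + 1) (i + 1) - adIter q p r j (k + 1) i) * hp - p ^ i * h
  have h2 : (∏ t ∈ Finset.range (k + 1), q ^ (j + t)) *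
      ∏ t ∈ Finset.range (k + 1), p ^ (j + t) = 1 := by
    rw [← Finset.prod_mul_distrib]
    exact Finset.prod_eq_one fun t _ => by rw [← mul_pow, hqp, one_pow]
  have h3 : ∏ t ∈ Finset.range (k + 1), (-(q ^ (j + t) * r)) =
      (∏ t ∈ Finset.range (k + 1), q ^ (j + t)) * (-r) ^ (k + 1) := by
    have h4 := Finset.prod_const (s := Finset.range (k + 1)) (-r)
    rw [Finset.card_range] at h4
    rw [← h4, ← Finset.prod_mul_distrib]
    exact Finset.prod_congr rfl fun t _ => by ring
  rw [h1, adIter_top, adIter_zero_right, h3]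
  linear_combination (∏ t ∈ Finset.range (k + 1), qBeta q r (j + t + 1)) * h2

theorem prod_neg_pow_even (q r : R) (j h : ℕ) :
    ∏ t ∈ Finset.range (2 * h), (-(q ^ (j + t) * r)) = (q ^ (2 * j + 2 * h - 1) * r ^ 2) ^ h := by
  rcases h with _ | h
  · simp
  · rw [show 2 * j + 2 * (h + 1) - 1 = 2 * j + 2 * h + 1 by omega]
    induction h with
    | zero => simp [Finset.prod_range_succ]; ring
    | succ h ih =>
      rw [show 2 * (h + 1 + 1) = 2 * (h + 1) + 1 + 1 by ring, Finset.prod_range_succ,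
        Finset.prod_range_succ, ih]
      ring

theorem prod_neg_pow_odd (q r : R) (j h : ℕ) :
    ∏ t ∈ Finset.range (2 * h + 1), (-(q ^ (j + t) * r)) = (-(q ^ (j + h) * r)) ^ (2 * h + 1) := by
  induction h generalizing j with
  | zero => simp
  | succ h ih =>
    rw [show 2 * (h + 1) + 1 = (2 * h + 1) + 1 + 1 by ring, Finset.prod_range_succ,
      Finset.prod_range_succ']
    have h1 : ∏ t ∈ Finset.range (2 * h + 1), (-(q ^ (j + (t + 1)) * r)) =
        (-(q ^ (j + 1 + h) * r)) ^ (2 * h + 1) := by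
      rw [← ih]
      exact Finset.prod_congr rfl fun t _ => by rw [show j + (t + 1) = j + 1 + t by ring]
    rw [h1, show j + 1 + h = j + (h + 1) by ring]
    ring

theorem map_qBeta {S : Type*} [CommRing S] (f : R →+* S) (q r : R) (k : ℕ) :
    f (qBeta q r k) = qBeta (f q) (f r) k := by
  simp [qBeta]

theorem map_adIter {S : Type*} [CommRing S] (f : R →+* S) (q p r : R) (j k i : ℕ) :
    f (adIter q p r j k i) = adIter (f q) (f p) (f r) j k i := by
  induction k generalizing i with
  | zero => simp [adIter]
  | succ k ih => simp [adIter, adSeq, map_qBeta, ih]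

/-- Cancellation of a factor of a polynomial identity that is nonzero at `0`. -/
theorem eval_eq_of_mul_eq {K : Type*} [Field K] {a f g : Polynomial K} (ha : a.eval 0 ≠ 0)
    (h : a * f = a * g) (r : K) : Polynomial.evalRingHom r f = Polynomial.evalRingHom r g := by
  have ha0 : a ≠ 0 := fun h0 => ha (by simp [h0])
  rw [mul_left_cancel₀ ha0 h]

/-- With $r$ replaced by $X$, the factor $1-q^{2j+k}X^2$ divides both sides of the telescoped
identity and is nonzero at $X=0$. Cancelling it before specialising gives a formula that survives
when it vanishes at $r$. -/
theorem sum_pow_adIter_even {K : Type*} [Field K] {q : K} (hq : q ≠ 0) (r : K) (j h k : ℕ)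
    (hk : k + 1 = 2 * h) :
    (∏ t ∈ Finset.range (k + 1), q ^ (j + t)) * (∑ t ∈ Finset.range (k + 1), q ^ t) *
          ∑ i ∈ Finset.range (j + k + 1), q⁻¹ ^ i * adIter q q⁻¹ r j k i =
      (∏ t ∈ Finset.range (k + 1), qBeta q r (j + t + 1)) *
        ∑ t ∈ Finset.range h, (q ^ (2 * j + k) * r ^ 2) ^ t := by
  have key := sum_pow_adIter (q := Polynomial.C q) (p := Polynomial.C q⁻¹)
    (by rw [← map_mul, mul_inv_cancel₀ hq, map_one]) Polynomial.X j k
  rw [show ∏ t ∈ Finset.range (k + 1), (-(Polynomial.C q ^ (j + t) * Polynomial.X)) =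
    (Polynomial.C q ^ (2 * j + k) * Polynomial.X ^ 2) ^ h by
      rw [hk, prod_neg_pow_even, show 2 * j + 2 * h - 1 = 2 * j + k by omega],
    ← mul_neg_geom_sum] at key
  have h2 := eval_eq_of_mul_eq (a := 1 - Polynomial.C q ^ (2 * j + k) * Polynomial.X ^ 2)
    (f := (∏ t ∈ Finset.range (k + 1), Polynomial.C q ^ (j + t)) *
      (∑ t ∈ Finset.range (k + 1), Polynomial.C q ^ t) *
        ∑ i ∈ Finset.range (j + k + 1), Polynomial.C q⁻¹ ^ i *
          adIter (Polynomial.C q) (Polynomial.C q⁻¹) Polynomial.X j k i)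
    (g := (∏ t ∈ Finset.range (k + 1), qBeta (Polynomial.C q) Polynomial.X (j + t + 1)) *
        ∑ t ∈ Finset.range h, (Polynomial.C q ^ (2 * j + k) * Polynomial.X ^ 2) ^ t)
    (by simp) (by linear_combination key) r
  simp only [map_mul, map_prod, map_sum, map_pow, map_adIter,
    map_qBeta] at h2
  simpa only [Polynomial.coe_evalRingHom, Polynomial.eval_C, Polynomial.eval_X] using h2

/-- Here $k$ is even, so $1-q^{2j+k}X^2$ splits. Only $1+q^{j+h}X$ is absorbed by the geometric sum
on the right; the other factor stays on the left. -/
theorem sum_pow_adIter_odd {K : Type*} [Field K] {q : K} (hq : q ≠ 0) (r : K) (j h k : ℕ)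
    (hk : k + 1 = 2 * h + 1) :
    (∏ t ∈ Finset.range (k + 1), q ^ (j + t)) * (∑ t ∈ Finset.range (k + 1), q ^ t) *
          (1 - q ^ (j + h) * r) *
          ∑ i ∈ Finset.range (j + k + 1), q⁻¹ ^ i * adIter q q⁻¹ r j k i =
      (∏ t ∈ Finset.range (k + 1), qBeta q r (j + t + 1)) *
        ∑ t ∈ Finset.range (k + 1), (-(q ^ (j + h) * r)) ^ t := by
  have key := sum_pow_adIter (q := Polynomial.C q) (p := Polynomial.C q⁻¹)
    (by rw [← map_mul, mul_inv_cancel₀ hq, map_one]) Polynomial.X j k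
  have hX : (1 : Polynomial K) - Polynomial.C q ^ (2 * j + k) * Polynomial.X ^ 2 =
      (1 + Polynomial.C q ^ (j + h) * Polynomial.X) *
        (1 - Polynomial.C q ^ (j + h) * Polynomial.X) := by
    rw [show 2 * j + k = (j + h) + (j + h) by omega, pow_add]; ring
  rw [show ∏ t ∈ Finset.range (k + 1), (-(Polynomial.C q ^ (j + t) * Polynomial.X)) =
    (-(Polynomial.C q ^ (j + h) * Polynomial.X)) ^ (k + 1) by rw [hk, prod_neg_pow_odd],
    ← mul_neg_geom_sum, hX] at key
  have h2 := eval_eq_of_mul_eq (a := 1 + Polynomial.C q ^ (j + h) * Polynomial.X)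
    (f := (∏ t ∈ Finset.range (k + 1), Polynomial.C q ^ (j + t)) *
      (∑ t ∈ Finset.range (k + 1), Polynomial.C q ^ t) *
      (1 - Polynomial.C q ^ (j + h) * Polynomial.X) *
        ∑ i ∈ Finset.range (j + k + 1), Polynomial.C q⁻¹ ^ i *
          adIter (Polynomial.C q) (Polynomial.C q⁻¹) Polynomial.X j k i)
    (g := (∏ t ∈ Finset.range (k + 1), qBeta (Polynomial.C q) Polynomial.X (j + t + 1)) *
        ∑ t ∈ Finset.range (k + 1), (-(Polynomial.C q ^ (j + h) * Polynomial.X)) ^ t)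
    (by simp) (by linear_combination key) r
  simp only [map_mul, map_prod, map_sum, map_pow, map_adIter,
    map_neg, map_sub, map_one, map_qBeta] at h2
  simpa only [Polynomial.coe_evalRingHom, Polynomial.eval_C, Polynomial.eval_X] using h2

theorem sum_pow_adIter_eq_zero {K : Type*} [Field K] {q : K} (hq : q ≠ 0) (r : K) {j n : ℕ}
    (hjn : j < n) (hn : qNum q (n - j) ≠ 0) (hX : q ^ (n + j - 1) * r ^ 2 = 1)
    (heven : Even (n - j) → qNum (q ^ (n + j - 1) * r ^ 2) ((n - j) / 2) = 0)
    (hodd : Odd (n - j) → qNum (-(q ^ ((n + j - 1) / 2) * r)) (n - j) = 0) :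
    ∑ i ∈ Finset.range n, q⁻¹ ^ i * adIter q q⁻¹ r j (n - j - 1) i = 0 := by
  obtain ⟨k, rfl⟩ := Nat.exists_eq_add_of_lt hjn
  rw [show j + k + 1 - j = k + 1 by omega] at *
  rw [show j + k + 1 + j - 1 = 2 * j + k by omega] at *
  rw [Nat.add_sub_cancel]
  have hprod : ∏ t ∈ Finset.range (k + 1), q ^ (j + t) ≠ 0 :=
    Finset.prod_ne_zero_iff.2 fun t _ => pow_ne_zero _ hq
  rw [qNum] at hn
  rcases Nat.even_or_odd (k + 1) with hk | hk
  · have h0 := heven hk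
    obtain ⟨h, hh⟩ := hk
    rw [show (k + 1) / 2 = h by omega] at h0
    have key := sum_pow_adIter_even hq r j h k (by omega)
    rw [qNum] at h0
    rw [h0, mul_zero] at key
    exact (mul_eq_zero.1 key).resolve_left (mul_ne_zero hprod hn)
  · have h0 := hodd hk
    obtain ⟨h, hh⟩ := hk
    rw [show (2 * j + k) / 2 = j + h by omega] at h0
    have key := sum_pow_adIter_odd hq r j h k (by omega)
    rw [qNum] at h0
    rw [h0, mul_zero] at key
    refine (mul_eq_zero.1 key).resolve_left (mul_ne_zero (mul_ne_zero hprod hn) fun h1 => ?_)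
    -- The remaining factor cannot vanish: otherwise $(k+1)_{-1}=0$ with $k+1$ odd, which forces
    -- $2=0$ in $K$ and then $k+1=0$ in $K$, although an odd number is $1$ there.
    have hY : -(q ^ (j + h) * r) = -1 := by linear_combination h1
    rw [hY] at h0
    have hpow := mul_neg_geom_sum (-1 : K) (k + 1)
    rw [h0, mul_zero, hh, pow_succ, pow_mul] at hpow
    have h2 : (1 : K) = -1 := by linear_combination -hpow
    rw [← h2] at h0
    have h3 : ((k + 1 : ℕ) : K) = 0 := by simpa using h0
    rw [hh] at h3
    push_cast at h3
    have h4 : (1 : K) = 0 := by linear_combination h3 - h * (h2 : (1 : K) = -1)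
    exact one_ne_zero h4

end Sequences

/-! ### The elements $u_k$ and $\hat u_k$ under $d_1$, $d_2$ and $\mathrm{ad}\,x_1$ -/

section RankTwoCalculus

variable {K : Type u} [Field K] {V : Type v} [AddCommGroup V] [Module K V]

/-- The normalization factor `(k)_q^! b_k` of `û_k`. -/
abbrev uNorm (Q : Fin 2 → Fin 2 → K) (k : ℕ) : K :=
  qFact (Q 0 0) k * bProd (Q 0 0) (Q 0 1 * Q 1 0) k

theorem uNorm_succ (Q : Fin 2 → Fin 2 → K) (k : ℕ) :
    uNorm Q (k + 1) = uNorm Q k * qBeta (Q 0 0) (Q 0 1 * Q 1 0) (k + 1) := by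
  simp only [uNorm, qFact, bProd, Finset.prod_range_succ, qBeta, qNum, Nat.add_sub_cancel]
  ring

theorem uNorm_ne_zero_of_le {Q : Fin 2 → Fin 2 → K} {m n : ℕ} (hm : uNorm Q m ≠ 0)
    (h : n ≤ m) : uNorm Q n ≠ 0 := by
  induction m, h using Nat.le_induction with
  | base => exact hm
  | succ m _ ih => rw [uNorm_succ] at hm; exact ih (left_ne_zero_of_mul hm)

theorem qBeta_ne_zero {Q : Fin 2 → Fin 2 → K} {m k : ℕ} (hm : uNorm Q m ≠ 0) (h : k < m) :
    qBeta (Q 0 0) (Q 0 1 * Q 1 0) (k + 1) ≠ 0 := by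
  have := uNorm_ne_zero_of_le hm h
  rw [Nat.succ_eq_add_one, uNorm_succ] at this
  exact right_ne_zero_of_mul this

theorem qNum_ne_zero {Q : Fin 2 → Fin 2 → K} {m k : ℕ} (hm : uNorm Q m ≠ 0) (h0 : k ≠ 0)
    (h : k ≤ m) : qNum (Q 0 0) k ≠ 0 := by
  obtain ⟨k, rfl⟩ := Nat.exists_eq_succ_of_ne_zero h0
  exact left_ne_zero_of_mul (qBeta_ne_zero hm h)

theorem twistL_zero_uElt (x : Module.Basis (Fin 2) K V) (Q : Fin 2 → Fin 2 → K) (k : ℕ) :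
    twistL x Q 0 (uElt x Q k) = (Q 0 0 ^ k * Q 0 1) • uElt x Q k := by
  induction k with
  | zero => simp [uElt, twistL_gen]
  | succ k ih =>
    simp only [uElt, map_sub, map_mul, map_smul, twistL_gen, ih, smul_sub, smul_mul_assoc,
      mul_smul_comm, smul_smul]
    congr 2 <;> ring

theorem twistR_zero_uElt (x : Module.Basis (Fin 2) K V) (Q : Fin 2 → Fin 2 → K) (k : ℕ) :
    twistR x Q 0 (uElt x Q k) = (Q 0 0 ^ k * Q 1 0) • uElt x Q k := by
  induction k with
  | zero => simp [uElt, twistR_gen]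
  | succ k ih =>
    simp only [uElt, map_sub, map_mul, map_smul, twistR_gen, ih, smul_sub, smul_mul_assoc,
      mul_smul_comm, smul_smul]
    congr 2 <;> ring

theorem twistR_one_uElt (x : Module.Basis (Fin 2) K V) (Q : Fin 2 → Fin 2 → K) (k : ℕ) :
    twistR x Q 1 (uElt x Q k) = (Q 0 1 ^ k * Q 1 1) • uElt x Q k := by
  induction k with
  | zero => simp [uElt, twistR_gen]
  | succ k ih =>
    simp only [uElt, map_sub, map_mul, map_smul, twistR_gen, ih, smul_sub, smul_mul_assoc,
      mul_smul_comm, smul_smul]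
    congr 2 <;> ring

theorem adGen_apply (x : Module.Basis (Fin 2) K V) (Q : Fin 2 → Fin 2 → K)
    (y : TensorAlgebra K V) :
    adGen x Q 0 y = gen x 0 * y - twistL x Q 0 y * gen x 0 := by
  simp [adGen]

theorem adGen_mul (x : Module.Basis (Fin 2) K V) (Q : Fin 2 → Fin 2 → K)
    (y z : TensorAlgebra K V) :
    adGen x Q 0 (y * z) = adGen x Q 0 y * z + twistL x Q 0 y * adGen x Q 0 z := by
  simp only [adGen_apply, map_mul, sub_mul, mul_sub, mul_assoc]
  abel

theorem adGen_uElt (x : Module.Basis (Fin 2) K V) (Q : Fin 2 → Fin 2 → K) (k : ℕ) :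
    adGen x Q 0 (uElt x Q k) = uElt x Q (k + 1) := by
  rw [adGen_apply, twistL_zero_uElt, smul_mul_assoc, uElt]

theorem skewDer_adGen (x : Module.Basis (Fin 2) K V) (Q : Fin 2 → Fin 2 → K)
    (y : TensorAlgebra K V) :
    skewDer x Q 0 (adGen x Q 0 y) =
      y - twistR x Q 0 (twistL x Q 0 y) + Q 0 0 • adGen x Q 0 (skewDer x Q 0 y) := by
  have h : skewDer x Q 0 (twistL x Q 0 y) = Q 0 0 • twistL x Q 0 (skewDer x Q 0 y) :=
    skewDer_diagHom x Q _ 0 y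
  rw [adGen_apply, map_sub, skewDer_gen_mul, skewDer_mul, h, skewDer_gen, adGen_apply]
  simp only [if_true, mul_one, smul_sub, smul_mul_assoc]
  abel

theorem skewDer_zero_uElt_zero (x : Module.Basis (Fin 2) K V) (Q : Fin 2 → Fin 2 → K) :
    skewDer x Q 0 (uElt x Q 0) = 0 := by
  simp [uElt, skewDer_gen]

/-- Commuting $d_1$ past $\mathrm{ad}\,x_1$ gives the recursion `qBeta_succ`. The normalization of
$\hat u_k$ is the product of these scalars. -/
theorem skewDer_zero_uElt_succ (x : Module.Basis (Fin 2) K V) (Q : Fin 2 → Fin 2 → K) (k : ℕ) :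
    skewDer x Q 0 (uElt x Q (k + 1)) =
      qBeta (Q 0 0) (Q 0 1 * Q 1 0) (k + 1) • uElt x Q k := by
  have h : ∀ k, skewDer x Q 0 (uElt x Q (k + 1)) =
      (1 - Q 0 0 ^ (2 * k) * (Q 0 1 * Q 1 0)) • uElt x Q k +
        Q 0 0 • adGen x Q 0 (skewDer x Q 0 (uElt x Q k)) := by
    intro k
    rw [← adGen_uElt, skewDer_adGen, twistL_zero_uElt, map_smul, twistR_zero_uElt, smul_smul,
      sub_smul, one_smul]
    congr 3; ring
  induction k with
  | zero => rw [h, skewDer_zero_uElt_zero, qBeta_succ, qBeta_zero]; simp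
  | succ k ih =>
    rw [h, ih, map_smul, adGen_uElt, smul_smul, ← add_smul, qBeta_succ _ _ (k + 1), add_comm]

theorem skewDer_one_uElt (x : Module.Basis (Fin 2) K V) (Q : Fin 2 → Fin 2 → K) (k : ℕ) :
    skewDer x Q 1 (uElt x Q k) = if k = 0 then 1 else 0 := by
  induction k with
  | zero => simp [uElt, skewDer_gen]
  | succ k ih =>
    rw [uElt, map_sub, map_smul, skewDer_gen_mul, skewDer_mul, skewDer_gen, ih]
    rcases k with _ | k <;> simp

theorem aug_uElt (x : Module.Basis (Fin 2) K V) (Q : Fin 2 → Fin 2 → K) (k : ℕ) :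
    aug (uElt x Q k) = 0 := by
  cases k <;> simp [uElt, aug_gen]

/-- The case distinction disappears because the inverse of zero is zero. -/
theorem uHat_eq (x : Module.Basis (Fin 2) K V) (Q : Fin 2 → Fin 2 → K) (k : ℕ) :
    uHat x Q k = (uNorm Q k)⁻¹ • uElt x Q k := by
  unfold uHat
  split_ifs with h
  · rfl
  · rw [not_not] at h
    rw [uNorm, h, inv_zero, zero_smul]

theorem skewDer_zero_uHat_zero (x : Module.Basis (Fin 2) K V) (Q : Fin 2 → Fin 2 → K) :
    skewDer x Q 0 (uHat x Q 0) = 0 := by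
  rw [uHat_eq, map_smul, skewDer_zero_uElt_zero, smul_zero]

theorem skewDer_zero_uHat_succ (x : Module.Basis (Fin 2) K V) {Q : Fin 2 → Fin 2 → K} {k m : ℕ}
    (hm : uNorm Q m ≠ 0) (hk : k < m) : skewDer x Q 0 (uHat x Q (k + 1)) = uHat x Q k := by
  rw [uHat_eq, uHat_eq, map_smul, skewDer_zero_uElt_succ, smul_smul, uNorm_succ]
  congr 1
  have := qBeta_ne_zero hm hk
  field_simp

theorem adGen_uHat (x : Module.Basis (Fin 2) K V) {Q : Fin 2 → Fin 2 → K} {k m : ℕ}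
    (hm : uNorm Q m ≠ 0) (hk : k < m) :
    adGen x Q 0 (uHat x Q k) = qBeta (Q 0 0) (Q 0 1 * Q 1 0) (k + 1) • uHat x Q (k + 1) := by
  rw [uHat_eq, uHat_eq, map_smul, adGen_uElt, smul_smul, uNorm_succ]
  congr 1
  have := qBeta_ne_zero hm hk
  field_simp

theorem twistL_zero_uHat (x : Module.Basis (Fin 2) K V) (Q : Fin 2 → Fin 2 → K) (k : ℕ) :
    twistL x Q 0 (uHat x Q k) = (Q 0 0 ^ k * Q 0 1) • uHat x Q k := by
  rw [uHat_eq, map_smul, twistL_zero_uElt, smul_comm]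

theorem twistR_zero_uHat (x : Module.Basis (Fin 2) K V) (Q : Fin 2 → Fin 2 → K) (k : ℕ) :
    twistR x Q 0 (uHat x Q k) = (Q 0 0 ^ k * Q 1 0) • uHat x Q k := by
  rw [uHat_eq, map_smul, twistR_zero_uElt, smul_comm]

theorem twistR_one_uHat (x : Module.Basis (Fin 2) K V) (Q : Fin 2 → Fin 2 → K) (k : ℕ) :
    twistR x Q 1 (uHat x Q k) = (Q 0 1 ^ k * Q 1 1) • uHat x Q k := by
  rw [uHat_eq, map_smul, twistR_one_uElt, smul_comm]

theorem uNorm_zero (Q : Fin 2 → Fin 2 → K) : uNorm Q 0 = 1 := by simp [uNorm, qFact, bProd]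

theorem skewDer_one_uHat (x : Module.Basis (Fin 2) K V) (Q : Fin 2 → Fin 2 → K) (k : ℕ) :
    skewDer x Q 1 (uHat x Q k) = if k = 0 then 1 else 0 := by
  rw [uHat_eq, map_smul, skewDer_one_uElt]
  split_ifs with h
  · subst h; simp [uNorm_zero]
  · simp

/-- The coefficient `(-q₂₁)^i q^(i(i-1)/2)` of `û_i û_{k-i}` in `P_k`. -/
def pCoeff (Q : Fin 2 → Fin 2 → K) (i : ℕ) : K := (-Q 1 0) ^ i * Q 0 0 ^ (i * (i - 1) / 2)

theorem triangle_exp_succ (i : ℕ) : (i + 1) * (i + 1 - 1) / 2 = i * (i - 1) / 2 + i := by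
  rw [← Finset.sum_range_id, ← Finset.sum_range_id, Finset.sum_range_succ]

theorem pCoeff_zero (Q : Fin 2 → Fin 2 → K) : pCoeff Q 0 = 1 := by simp [pCoeff]

theorem pCoeff_succ (Q : Fin 2 → Fin 2 → K) (i : ℕ) :
    pCoeff Q (i + 1) = -Q 1 0 * Q 0 0 ^ i * pCoeff Q i := by
  rw [pCoeff, triangle_exp_succ, pCoeff]; ring

theorem pCoeff_ne_zero {Q : Fin 2 → Fin 2 → K} (hQ : ∀ i j, Q i j ≠ 0) (i : ℕ) :
    pCoeff Q i ≠ 0 :=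
  mul_ne_zero (pow_ne_zero _ (neg_ne_zero.2 (hQ 1 0))) (pow_ne_zero _ (hQ 0 0))

/-! ### Elements of $U_n$ as coefficient sequences -/

/-- The element of `U_n` with normalized coefficients `c`. -/
def pairSum (x : Module.Basis (Fin 2) K V) (Q : Fin 2 → Fin 2 → K) (n : ℕ) :
    (ℕ → K) →ₗ[K] TensorAlgebra K V where
  toFun c := ∑ i ∈ Finset.range (n + 1), (c i * pCoeff Q i) • (uHat x Q i * uHat x Q (n - i))
  map_add' c d := by simp only [Pi.add_apply, add_mul, add_smul, Finset.sum_add_distrib]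
  map_smul' a c := by
    simp only [Pi.smul_apply, smul_eq_mul, mul_assoc, mul_smul, Finset.smul_sum, RingHom.id_apply]

theorem pairSum_apply (x : Module.Basis (Fin 2) K V) (Q : Fin 2 → Fin 2 → K) (n : ℕ)
    (c : ℕ → K) : pairSum x Q n c =
      ∑ i ∈ Finset.range (n + 1), (c i * pCoeff Q i) • (uHat x Q i * uHat x Q (n - i)) := rfl

theorem pairSum_congr (x : Module.Basis (Fin 2) K V) (Q : Fin 2 → Fin 2 → K) {n : ℕ}
    {c c' : ℕ → K} (h : ∀ i ≤ n, c i = c' i) : pairSum x Q n c = pairSum x Q n c' := by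
  rw [pairSum_apply, pairSum_apply]
  exact Finset.sum_congr rfl fun i hi => by rw [h i (Nat.lt_succ_iff.1 (Finset.mem_range.1 hi))]

theorem pElt_eq_pairSum (x : Module.Basis (Fin 2) K V) (Q : Fin 2 → Fin 2 → K) (n : ℕ) :
    pElt x Q n = pairSum x Q n fun _ => 1 := by
  rw [pairSum_apply]
  exact Finset.sum_congr rfl fun i _ => by rw [one_mul, pCoeff]

theorem aug_pairSum (x : Module.Basis (Fin 2) K V) (Q : Fin 2 → Fin 2 → K) (n : ℕ)
    (c : ℕ → K) : aug (pairSum x Q n c) = 0 := by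
  rw [pairSum_apply, map_sum]
  refine Finset.sum_eq_zero fun i _ => ?_
  rw [map_smul, map_mul, uHat_eq, map_smul, aug_uElt, smul_zero, zero_mul, smul_zero]

theorem skewDer_zero_pairSum_zero (x : Module.Basis (Fin 2) K V) (Q : Fin 2 → Fin 2 → K)
    (c : ℕ → K) : skewDer x Q 0 (pairSum x Q 0 c) = 0 := by
  simp [pairSum_apply, skewDer_mul, skewDer_zero_uHat_zero]

/-- The ratio of consecutive weights `pCoeff` is minus the twist $\chi(\deg u_i,\alpha_1)$, so the
two halves of the Leibniz rule combine into a difference. -/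
theorem skewDer_zero_pairSum_succ (x : Module.Basis (Fin 2) K V) {Q : Fin 2 → Fin 2 → K}
    {n : ℕ} (hn : uNorm Q (n + 1) ≠ 0) (c : ℕ → K) :
    skewDer x Q 0 (pairSum x Q (n + 1) c) =
      (-Q 1 0) • pairSum x Q n fun i => Q 0 0 ^ i * (c (i + 1) - c i) := by
  have h1 : ∑ i ∈ Finset.range (n + 2), (c i * pCoeff Q i) •
      (skewDer x Q 0 (uHat x Q i) * uHat x Q (n + 1 - i)) =
      ∑ i ∈ Finset.range (n + 1), (c (i + 1) * pCoeff Q (i + 1)) •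
        (uHat x Q i * uHat x Q (n - i)) := by
    rw [Finset.sum_range_succ', skewDer_zero_uHat_zero, zero_mul, smul_zero, add_zero]
    refine Finset.sum_congr rfl fun i hi => ?_
    rw [skewDer_zero_uHat_succ x hn (Finset.mem_range.1 hi), Nat.add_sub_add_right]
  have h2 : ∑ i ∈ Finset.range (n + 2), (c i * pCoeff Q i) •
      (twistR x Q 0 (uHat x Q i) * skewDer x Q 0 (uHat x Q (n + 1 - i))) =
      ∑ i ∈ Finset.range (n + 1), (c i * pCoeff Q i * (Q 0 0 ^ i * Q 1 0)) •
        (uHat x Q i * uHat x Q (n - i)) := by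
    rw [Finset.sum_range_succ, Nat.sub_self, skewDer_zero_uHat_zero, mul_zero, smul_zero,
      add_zero]
    refine Finset.sum_congr rfl fun i hi => ?_
    have hi' := Finset.mem_range.1 hi
    rw [show n + 1 - i = n - i + 1 by omega, skewDer_zero_uHat_succ x hn (by omega),
      twistR_zero_uHat, smul_mul_assoc, smul_smul]
  rw [pairSum_apply, map_sum]
  simp only [map_smul, skewDer_mul, smul_add]
  rw [Finset.sum_add_distrib, h1, h2, ← Finset.sum_add_distrib, pairSum_apply, Finset.smul_sum]
  refine Finset.sum_congr rfl fun i _ => ?_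
  rw [← add_smul, smul_smul, pCoeff_succ]
  congr 1; ring

theorem adGen_pairSum (x : Module.Basis (Fin 2) K V) {Q : Fin 2 → Fin 2 → K}
    (hq : Q 0 0 ≠ 0) {n : ℕ} (hn : uNorm Q (n + 1) ≠ 0) (c : ℕ → K) :
    (-Q 1 0) • adGen x Q 0 (pairSum x Q n c) =
      pairSum x Q (n + 1) (adSeq (Q 0 0) (Q 0 0)⁻¹ (Q 0 1 * Q 1 0) (n + 1) c) := by
  have h1 : ∀ i ∈ Finset.range (n + 1), (-Q 1 0) • (c i * pCoeff Q i) •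
      adGen x Q 0 (uHat x Q i * uHat x Q (n - i)) =
      (qBeta (Q 0 0) (Q 0 1 * Q 1 0) (i + 1) * (Q 0 0)⁻¹ ^ i * c i * pCoeff Q (i + 1)) •
        (uHat x Q (i + 1) * uHat x Q (n - i)) -
      (Q 0 0 ^ i * (Q 0 1 * Q 1 0) * qBeta (Q 0 0) (Q 0 1 * Q 1 0) (n + 1 - i) * c i *
        pCoeff Q i) • (uHat x Q i * uHat x Q (n + 1 - i)) := by
    intro i hi
    have hi' := Finset.mem_range.1 hi
    rw [adGen_mul, adGen_uHat x hn (by omega), adGen_uHat x hn (by omega), twistL_zero_uHat,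
      show n - i + 1 = n + 1 - i by omega, pCoeff_succ, smul_mul_assoc, smul_mul_assoc,
      mul_smul_comm, smul_add, smul_add, sub_eq_add_neg, ← neg_smul]
    simp only [smul_smul]
    congr 2
    · have : (Q 0 0)⁻¹ ^ i * Q 0 0 ^ i = 1 := by rw [← mul_pow, inv_mul_cancel₀ hq, one_pow]
      linear_combination (qBeta (Q 0 0) (Q 0 1 * Q 1 0) (i + 1) * c i * Q 1 0 * pCoeff Q i) * this
    · ring
  rw [pairSum_apply, map_sum, Finset.smul_sum]
  simp only [map_smul]
  rw [Finset.sum_congr rfl h1, Finset.sum_sub_distrib, pairSum_apply]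
  simp only [adSeq, sub_mul, sub_smul]
  rw [Finset.sum_sub_distrib]
  congr 1
  · rw [Finset.sum_range_succ' _ (n + 1)]
    simp only [qBeta_zero, zero_mul, zero_smul, add_zero, Nat.add_sub_cancel,
      Nat.add_sub_add_right]
  · rw [Finset.sum_range_succ _ (n + 1)]
    simp [qBeta_zero]

/-- Since $d_2$ kills $\hat u_k$ for $k>0$, the first half of the Leibniz rule retains only $i=0$
and the second only $i=n$. -/
theorem skewDer_one_pairSum (x : Module.Basis (Fin 2) K V) (Q : Fin 2 → Fin 2 → K)
    (n : ℕ) (c : ℕ → K) :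
    skewDer x Q 1 (pairSum x Q n c) =
      (c 0 + c n * (Q 0 0 ^ (n * (n - 1) / 2) * (-(Q 0 1 * Q 1 0)) ^ n * Q 1 1)) •
        uHat x Q n := by
  rw [pairSum_apply, map_sum]
  simp only [map_smul, skewDer_mul, smul_add, skewDer_one_uHat, twistR_one_uHat]
  rw [Finset.sum_add_distrib, add_smul]
  congr 1
  · rw [Finset.sum_range_succ']
    simp [pCoeff_zero]
  · rw [Finset.sum_range_succ, Finset.sum_eq_zero]
    · simp only [Nat.sub_self, if_true, mul_one, zero_add, smul_smul, pCoeff]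
      congr 1
      rw [show (-(Q 0 1 * Q 1 0)) ^ n = (-Q 1 0) ^ n * Q 0 1 ^ n by rw [← mul_pow]; ring]
      ring
    · intro i hi
      have hi' := Finset.mem_range.1 hi
      rw [if_neg (by omega), mul_zero, smul_zero]

/-! ### Linear independence of the products $\hat u_i\hat u_{n-i}$ -/

/-- A three-dimensional representation of `T(V)` separating the `û_0 û_n` from the other
products `û_i û_{n-i}`. -/
def rep3 (x : Module.Basis (Fin 2) K V) : TensorAlgebra K V →ₐ[K] Matrix (Fin 3) (Fin 3) K :=
  TensorAlgebra.lift K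
    (x.constr K ![Matrix.single 0 0 1, Matrix.single 1 0 1 + Matrix.single 2 1 1])

theorem rep3_gen_zero (x : Module.Basis (Fin 2) K V) :
    rep3 x (gen x 0) = Matrix.single 0 0 1 := by simp [rep3, gen]

theorem rep3_gen_one (x : Module.Basis (Fin 2) K V) :
    rep3 x (gen x 1) = Matrix.single 1 0 1 + Matrix.single 2 1 1 := by simp [rep3, gen]

theorem rep3_uElt_succ (x : Module.Basis (Fin 2) K V) {Q : Fin 2 → Fin 2 → K}
    (hQ : ∀ i j, Q i j ≠ 0) (k : ℕ) :
    ∃ a : K, a ≠ 0 ∧ rep3 x (uElt x Q (k + 1)) = Matrix.single 1 0 a := by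
  induction k with
  | zero =>
    refine ⟨-Q 0 1, neg_ne_zero.2 (hQ 0 1), ?_⟩
    rw [uElt, uElt, map_sub, map_smul, map_mul, map_mul, rep3_gen_zero, rep3_gen_one]
    ext i j
    fin_cases i <;> fin_cases j <;>
      simp [Matrix.mul_apply, Matrix.single_apply]
  | succ k ih =>
    obtain ⟨a, ha, h⟩ := ih
    refine ⟨-(Q 0 0 ^ (k + 1) * Q 0 1 * a),
      neg_ne_zero.2 (mul_ne_zero (mul_ne_zero (pow_ne_zero _ (hQ 0 0)) (hQ 0 1)) ha), ?_⟩
    rw [uElt, map_sub, map_smul, map_mul, map_mul, rep3_gen_zero, h]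
    ext i j
    fin_cases i <;> fin_cases j <;>
      simp

/-- For $i>0$ the image of $\hat u_i$ under `rep3` is supported in row $1$, so only the product with
$i=0$ has a nonzero entry at $(2,0)$. -/
theorem coeff_zero_of_pairSum_eq_zero (x : Module.Basis (Fin 2) K V) {Q : Fin 2 → Fin 2 → K}
    (hQ : ∀ i j, Q i j ≠ 0) {n : ℕ} (hn : uNorm Q n ≠ 0) {c : ℕ → K}
    (h : pairSum x Q n c = 0) : c 0 = 0 := by
  have h20 := congrArg (fun y => rep3 x y 2 0) h
  simp only [pairSum_apply, map_sum, map_smul, map_zero, map_mul, Matrix.sum_apply,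
    Matrix.smul_apply, Matrix.zero_apply] at h20
  rw [Finset.sum_range_succ', Finset.sum_eq_zero, zero_add, Nat.sub_zero, pCoeff_zero,
    mul_one] at h20
  · have hu : rep3 x (uHat x Q n) 1 0 ≠ 0 := by
      rw [uHat_eq, map_smul, Matrix.smul_apply]
      refine smul_ne_zero (inv_ne_zero hn) ?_
      cases n with
      | zero => simp [uElt, rep3_gen_one]
      | succ n =>
        obtain ⟨a, ha, h⟩ := rep3_uElt_succ x hQ n
        rw [h]; simpa [Matrix.single_apply] using ha
    have h0 : uHat x Q 0 = gen x 1 := by rw [uHat_eq, uNorm_zero, inv_one, one_smul, uElt]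
    rw [h0, rep3_gen_one] at h20
    have h1 : ((Matrix.single 1 0 1 + Matrix.single 2 1 1 : Matrix (Fin 3) (Fin 3) K) *
        rep3 x (uHat x Q n)) 2 0 = rep3 x (uHat x Q n) 1 0 := by
      simp [Matrix.mul_apply, Matrix.single_apply]
    rw [h1] at h20
    exact (smul_eq_zero.1 h20).resolve_right hu
  · intro i _
    obtain ⟨a, -, ha⟩ := rep3_uElt_succ x hQ i
    rw [uHat_eq, map_smul, ha]
    simp [Matrix.mul_apply]

/-- Applying $d_1$ and inducting on $n$ shows that $c$ is constant; the representation gives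
$c_0=0$. -/
theorem coeff_of_pairSum_eq_zero (x : Module.Basis (Fin 2) K V) {Q : Fin 2 → Fin 2 → K}
    (hQ : ∀ i j, Q i j ≠ 0) {n : ℕ} (hn : uNorm Q n ≠ 0) {c : ℕ → K}
    (h : pairSum x Q n c = 0) {i : ℕ} (hi : i ≤ n) : c i = 0 := by
  induction n generalizing c i with
  | zero => rw [Nat.le_zero.1 hi]; exact coeff_zero_of_pairSum_eq_zero x hQ hn h
  | succ n ih =>
    have h0 := coeff_zero_of_pairSum_eq_zero x hQ hn h
    have h1 := skewDer_zero_pairSum_succ x hn c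
    rw [h, map_zero, eq_comm, smul_eq_zero, neg_eq_zero] at h1
    have h2 := fun {i} => ih (uNorm_ne_zero_of_le hn n.le_succ) (h1.resolve_left (hQ 1 0)) (i := i)
    induction i with
    | zero => exact h0
    | succ i ih' =>
      have h3 := (mul_eq_zero.1 (h2 (by omega : i ≤ n))).resolve_left (pow_ne_zero _ (hQ 0 0))
      rw [sub_eq_zero.1 h3, ih' (by omega)]

theorem pairSum_mem_uSpace (x : Module.Basis (Fin 2) K V) (Q : Fin 2 → Fin 2 → K) (n : ℕ)
    (c : ℕ → K) : pairSum x Q n c ∈ uSpace x Q n := by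
  rw [pairSum_apply]
  refine Submodule.sum_mem _ fun i hi => Submodule.smul_mem _ _ ?_
  rw [uHat_eq, uHat_eq, smul_mul_assoc, mul_smul_comm]
  exact Submodule.smul_mem _ _ (Submodule.smul_mem _ _ (Submodule.subset_span
    ⟨i, Nat.lt_succ_iff.1 (Finset.mem_range.1 hi), rfl⟩))

theorem pairSum_mem_uSpace' (x : Module.Basis (Fin 2) K V) (Q : Fin 2 → Fin 2 → K) {n : ℕ}
    {c : ℕ → K} (hc : c n = 0) : pairSum x Q n c ∈ uSpace' x Q n := by
  rw [pairSum_apply, Finset.sum_range_succ, hc, zero_mul, zero_smul, add_zero]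
  refine Submodule.sum_mem _ fun i hi => Submodule.smul_mem _ _ ?_
  rw [uHat_eq, uHat_eq, smul_mul_assoc, mul_smul_comm]
  exact Submodule.smul_mem _ _ (Submodule.smul_mem _ _ (Submodule.subset_span
    ⟨i, Finset.mem_range.1 hi, rfl⟩))

theorem uElt_mul_eq_pairSum (x : Module.Basis (Fin 2) K V) {Q : Fin 2 → Fin 2 → K}
    (hQ : ∀ i j, Q i j ≠ 0) {n i : ℕ} (hn : uNorm Q n ≠ 0) (hi : i ≤ n) :
    uElt x Q i * uElt x Q (n - i) =
      pairSum x Q n (Pi.single i ((pCoeff Q i)⁻¹ * uNorm Q i * uNorm Q (n - i))) := by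
  rw [pairSum_apply, Finset.sum_eq_single i]
  · have h1 := uNorm_ne_zero_of_le hn hi
    have h2 := uNorm_ne_zero_of_le hn (Nat.sub_le n i)
    have h3 := pCoeff_ne_zero hQ i
    rw [Pi.single_eq_same, uHat_eq, uHat_eq, smul_mul_assoc, mul_smul_comm, smul_smul, smul_smul]
    generalize uNorm Q i = a at *
    generalize uNorm Q (n - i) = b at *
    rw [show (pCoeff Q i)⁻¹ * a * b * pCoeff Q i * a⁻¹ * b⁻¹ = 1 by field_simp, one_smul]
  · intro j _ hj
    rw [Pi.single_eq_of_ne hj, zero_mul, zero_smul]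
  · intro h
    exact absurd (Finset.mem_range.2 (Nat.lt_succ_iff.2 hi)) h

theorem exists_pairSum_of_mem_uSpace' {x : Module.Basis (Fin 2) K V} {Q : Fin 2 → Fin 2 → K}
    (hQ : ∀ i j, Q i j ≠ 0) {n : ℕ} (hn : uNorm Q n ≠ 0) {y : TensorAlgebra K V}
    (hy : y ∈ uSpace' x Q n) : ∃ c : ℕ → K, c n = 0 ∧ y = pairSum x Q n c := by
  induction hy using Submodule.span_induction with
  | mem y hy =>
    obtain ⟨i, hi, rfl⟩ := hy
    exact ⟨_, Pi.single_eq_of_ne (by omega) _, uElt_mul_eq_pairSum x hQ hn hi.le⟩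
  | zero => exact ⟨0, rfl, (map_zero _).symm⟩
  | add y z _ _ hy hz =>
    obtain ⟨c, hc, rfl⟩ := hy
    obtain ⟨d, hd, rfl⟩ := hz
    exact ⟨c + d, by simp [hc, hd], (map_add _ _ _).symm⟩
  | smul a y _ hy =>
    obtain ⟨c, hc, rfl⟩ := hy
    exact ⟨a • c, by simp [hc], (map_smul _ _ _).symm⟩

/-! ### Powers of $\mathrm{ad}\,x_1$ on $U_n$ -/

theorem uSpace'_le (x : Module.Basis (Fin 2) K V) (Q : Fin 2 → Fin 2 → K) (n : ℕ) :
    uSpace' x Q n ≤ uSpace x Q n :=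
  Submodule.span_mono fun _ ⟨i, hi, h⟩ => ⟨i, hi.le, h⟩

theorem twistL_zero_of_mem_uSpace {x : Module.Basis (Fin 2) K V} {Q : Fin 2 → Fin 2 → K} {n : ℕ}
    {y : TensorAlgebra K V} (hy : y ∈ uSpace x Q n) :
    twistL x Q 0 y = (Q 0 0 ^ n * Q 0 1 ^ 2) • y := by
  induction hy using Submodule.span_induction with
  | mem y hy =>
    obtain ⟨i, hi, rfl⟩ := hy
    rw [map_mul, twistL_zero_uElt, twistL_zero_uElt, smul_mul_smul_comm]
    congr 1
    obtain ⟨k, rfl⟩ := Nat.exists_eq_add_of_le hi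
    rw [Nat.add_sub_cancel_left]; ring
  | zero => simp
  | add y z _ _ hy hz => rw [map_add, hy, hz, smul_add]
  | smul a y _ hy => rw [map_smul, hy, smul_comm]

theorem twistR_zero_of_mem_uSpace {x : Module.Basis (Fin 2) K V} {Q : Fin 2 → Fin 2 → K} {n : ℕ}
    {y : TensorAlgebra K V} (hy : y ∈ uSpace x Q n) :
    twistR x Q 0 y = (Q 0 0 ^ n * Q 1 0 ^ 2) • y := by
  induction hy using Submodule.span_induction with
  | mem y hy =>
    obtain ⟨i, hi, rfl⟩ := hy
    rw [map_mul, twistR_zero_uElt, twistR_zero_uElt, smul_mul_smul_comm]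
    congr 1
    obtain ⟨k, rfl⟩ := Nat.exists_eq_add_of_le hi
    rw [Nat.add_sub_cancel_left]; ring
  | zero => simp
  | add y z _ _ hy hz => rw [map_add, hy, hz, smul_add]
  | smul a y _ hy => rw [map_smul, hy, smul_comm]

theorem adGen_mem_uSpace {x : Module.Basis (Fin 2) K V} {Q : Fin 2 → Fin 2 → K} {n : ℕ}
    {y : TensorAlgebra K V} (hy : y ∈ uSpace x Q n) : adGen x Q 0 y ∈ uSpace x Q (n + 1) := by
  induction hy using Submodule.span_induction with
  | mem y hy =>
    obtain ⟨i, hi, rfl⟩ := hy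
    rw [adGen_mul, adGen_uElt, adGen_uElt, twistL_zero_uElt, smul_mul_assoc]
    refine Submodule.add_mem _ (Submodule.subset_span ⟨i + 1, by omega, ?_⟩)
      (Submodule.smul_mem _ _ (Submodule.subset_span ⟨i, by omega, ?_⟩))
    · rw [Nat.add_sub_add_right]
    · rw [show n + 1 - i = n - i + 1 by omega]
  | zero => simp
  | add y z _ _ hy hz => rw [map_add]; exact Submodule.add_mem _ hy hz
  | smul a y _ hy => rw [map_smul]; exact Submodule.smul_mem _ _ hy

theorem adGen_pow_mem_uSpace {x : Module.Basis (Fin 2) K V} {Q : Fin 2 → Fin 2 → K} {n : ℕ}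
    {y : TensorAlgebra K V} (hy : y ∈ uSpace x Q n) (k : ℕ) :
    (adGen x Q 0 ^ k) y ∈ uSpace x Q (n + k) := by
  induction k with
  | zero => simpa using hy
  | succ k ih => rw [pow_succ', Module.End.mul_apply]; exact adGen_mem_uSpace ih

theorem skewDer_adGen_of_mem_uSpace {x : Module.Basis (Fin 2) K V} {Q : Fin 2 → Fin 2 → K}
    {n : ℕ} {y : TensorAlgebra K V} (hy : y ∈ uSpace x Q n) :
    skewDer x Q 0 (adGen x Q 0 y) =
      (1 - Q 0 0 ^ (2 * n) * (Q 0 1 * Q 1 0) ^ 2) • y +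
        Q 0 0 • adGen x Q 0 (skewDer x Q 0 y) := by
  rw [skewDer_adGen, twistL_zero_of_mem_uSpace hy, map_smul, twistR_zero_of_mem_uSpace hy,
    smul_smul, sub_smul, one_smul]
  congr 3; ring

theorem skewDer_adGen_pow {x : Module.Basis (Fin 2) K V} {Q : Fin 2 → Fin 2 → K}
    {n : ℕ} {y : TensorAlgebra K V} (hy : y ∈ uSpace x Q n) (k : ℕ) :
    skewDer x Q 0 ((adGen x Q 0 ^ (k + 1)) y) =
      (qNum (Q 0 0) (k + 1) * (1 - Q 0 0 ^ (2 * n + k) * (Q 0 1 * Q 1 0) ^ 2)) •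
          (adGen x Q 0 ^ k) y +
        Q 0 0 ^ (k + 1) • (adGen x Q 0 ^ (k + 1)) (skewDer x Q 0 y) := by
  induction k with
  | zero => simpa [qNum] using skewDer_adGen_of_mem_uSpace hy
  | succ k ih =>
    have hs : ∀ (k : ℕ) (z : TensorAlgebra K V),
        (adGen x Q 0 ^ (k + 1)) z = adGen x Q 0 ((adGen x Q 0 ^ k) z) := fun k z => by
      rw [pow_succ', Module.End.mul_apply]
    rw [hs, skewDer_adGen_of_mem_uSpace (adGen_pow_mem_uSpace hy (k + 1)), ih, map_add, map_smul,
      map_smul, ← hs, ← hs, smul_add, smul_smul, smul_smul, ← add_assoc, ← add_smul, ← pow_succ']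
    congr 2
    have h1 : qNum (Q 0 0) (k + 1 + 1) = Q 0 0 * qNum (Q 0 0) (k + 1) + 1 := geom_sum_succ
    have h2 : qNum (Q 0 0) (k + 1 + 1) = Q 0 0 ^ (k + 1) + qNum (Q 0 0) (k + 1) :=
      geom_sum_succ'
    linear_combination (Q 0 0 ^ (2 * n + k + 1) * (Q 0 1 * Q 1 0) ^ 2) * h2 - h1

theorem skewDer_zero_pElt (x : Module.Basis (Fin 2) K V) {Q : Fin 2 → Fin 2 → K} {n : ℕ}
    (hn : uNorm Q n ≠ 0) : skewDer x Q 0 (pElt x Q n) = 0 := by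
  rw [pElt_eq_pairSum]
  cases n with
  | zero => exact skewDer_zero_pairSum_zero x Q _
  | succ n =>
    rw [skewDer_zero_pairSum_succ x hn]
    simp only [sub_self, mul_zero]
    rw [show (fun _ : ℕ => (0 : K)) = 0 from rfl, map_zero, smul_zero]

theorem pElt_mem_uSpace (x : Module.Basis (Fin 2) K V) (Q : Fin 2 → Fin 2 → K) (n : ℕ) :
    pElt x Q n ∈ uSpace x Q n := by
  rw [pElt_eq_pairSum]; exact pairSum_mem_uSpace x Q n _

theorem adGen_pow_pElt (x : Module.Basis (Fin 2) K V) {Q : Fin 2 → Fin 2 → K}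
    (hQ : ∀ i j, Q i j ≠ 0) {j k : ℕ} (hn : uNorm Q (j + k) ≠ 0) :
    (-Q 1 0) ^ k • (adGen x Q 0 ^ k) (pElt x Q j) =
      pairSum x Q (j + k) (adIter (Q 0 0) (Q 0 0)⁻¹ (Q 0 1 * Q 1 0) j k) := by
  induction k with
  | zero => simp [pElt_eq_pairSum, adIter]
  | succ k ih =>
    rw [pow_succ' (adGen x Q 0), Module.End.mul_apply, pow_succ', mul_smul, ← map_smul,
      ih (uNorm_ne_zero_of_le hn (by omega))]
    exact adGen_pairSum x (hQ 0 0) hn _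

/-- Up to a nonzero scalar, its coefficient at $i=0$ is a power of $-r$ times factors of
$(j+k)_q^!\,b_{j+k}$, all nonzero. -/
theorem adGen_pow_pElt_ne_zero (x : Module.Basis (Fin 2) K V) {Q : Fin 2 → Fin 2 → K}
    (hQ : ∀ i j, Q i j ≠ 0) {j k : ℕ} (hn : uNorm Q (j + k) ≠ 0) :
    (adGen x Q 0 ^ k) (pElt x Q j) ≠ 0 := by
  intro h
  have h1 := adGen_pow_pElt x hQ hn
  rw [h, smul_zero, eq_comm] at h1
  have h2 := coeff_zero_of_pairSum_eq_zero x hQ hn h1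
  rw [adIter_zero_right] at h2
  refine mul_ne_zero (pow_ne_zero _ (neg_ne_zero.2 (mul_ne_zero (hQ 0 1) (hQ 1 0))))
    (Finset.prod_ne_zero_iff.2 fun t ht => ?_) h2
  exact qBeta_ne_zero hn (by have := Finset.mem_range.1 ht; omega)

end RankTwoCalculus

/-! ### Membership in the kernel and construction of $L_n$ -/

section Relations

variable {K : Type u} [Field K] {V : Type v} [AddCommGroup V] [Module K V]

theorem vanishing_le_kerPi (x : Module.Basis (Fin 2) K V) (Q : Fin 2 → Fin 2 → K) :
    vanishing x Q ≤ kerPi x Q :=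
  fun _ hy => LinearMap.mem_ker.2 (nicholsPi_eq_zero_of_mem_vanishing hy)

theorem adGen_mem_vanishing {x : Module.Basis (Fin 2) K V} {Q : Fin 2 → Fin 2 → K}
    {y : TensorAlgebra K V} (hy : y ∈ vanishing x Q) : adGen x Q 0 y ∈ vanishing x Q := by
  rw [adGen_apply]
  exact Submodule.sub_mem _ (mul_mem_vanishing_left _ hy)
    (mul_mem_vanishing_right _ (diagHom_mem_vanishing _ hy))

theorem adGen_pow_mem_vanishing {x : Module.Basis (Fin 2) K V} {Q : Fin 2 → Fin 2 → K}
    {y : TensorAlgebra K V} (hy : y ∈ vanishing x Q) (k : ℕ) :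
    (adGen x Q 0 ^ k) y ∈ vanishing x Q := by
  induction k with
  | zero => simpa using hy
  | succ k ih => rw [pow_succ', Module.End.mul_apply]; exact adGen_mem_vanishing ih

/-- Needed for $L_n$, which is only assumed to lie in $\ker\pi$. On $U_n$ the twist is a scalar, so
no stability of $\ker\pi$ under twists is required. -/
theorem adGen_pow_mem_kerPi {x : Module.Basis (Fin 2) K V} {Q : Fin 2 → Fin 2 → K} {n : ℕ}
    {y : TensorAlgebra K V} (hy : y ∈ kerPi x Q) (hu : y ∈ uSpace x Q n) (k : ℕ) :
    (adGen x Q 0 ^ k) y ∈ kerPi x Q := by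
  induction k with
  | zero => simpa using hy
  | succ k ih =>
    have h0 : nicholsPi x Q ((adGen x Q 0 ^ k) y) = 0 := ih
    rw [pow_succ', Module.End.mul_apply, adGen_apply,
      twistL_zero_of_mem_uSpace (adGen_pow_mem_uSpace hu k)]
    change nicholsPi x Q _ = 0
    rw [map_sub, map_mul, map_mul, map_smul, h0, mul_zero, smul_zero, zero_mul, sub_zero]

theorem pElt_mem_vanishing (x : Module.Basis (Fin 2) K V) {Q : Fin 2 → Fin 2 → K} {n : ℕ}
    (hn : uNorm Q n ≠ 0)
    (h : Q 0 0 ^ (n * (n - 1) / 2) * (-(Q 0 1 * Q 1 0)) ^ n * Q 1 1 = -1) :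
    pElt x Q n ∈ vanishing x Q := by
  rw [mem_vanishing_iff]
  refine ⟨by rw [pElt_eq_pairSum, aug_pairSum], fun i => ?_⟩
  fin_cases i
  · exact (skewDer_zero_pElt x hn).symm ▸ Submodule.zero_mem _
  · change skewDer x Q 1 (pElt x Q n) ∈ _
    rw [pElt_eq_pairSum, skewDer_one_pairSum, h]
    simp

/-- Vanishing of $d_1$ makes the coefficient sequence constant, and in $U'_n$ its last term is zero.
-/
theorem eq_zero_of_mem_uSpace'_of_skewDer_eq_zero {x : Module.Basis (Fin 2) K V}
    {Q : Fin 2 → Fin 2 → K} (hQ : ∀ i j, Q i j ≠ 0) {n : ℕ} (hn : uNorm Q n ≠ 0)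
    {y : TensorAlgebra K V} (hy : y ∈ uSpace' x Q n) (h : skewDer x Q 0 y = 0) : y = 0 := by
  obtain ⟨c, hc, rfl⟩ := exists_pairSum_of_mem_uSpace' hQ hn hy
  suffices h0 : ∀ i ≤ n, c i = 0 by
    rw [pairSum_congr x Q (c' := 0) h0, map_zero]
  cases n with
  | zero => intro i hi; rw [Nat.le_zero.1 hi, hc]
  | succ n =>
    rw [skewDer_zero_pairSum_succ x hn, smul_eq_zero, neg_eq_zero] at h
    have h1 : ∀ i ≤ n, c (i + 1) = c i := fun i hi => sub_eq_zero.1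
      ((mul_eq_zero.1 (coeff_of_pairSum_eq_zero x hQ (uNorm_ne_zero_of_le hn n.le_succ)
        (h.resolve_left (hQ 1 0)) hi)).resolve_left (pow_ne_zero _ (hQ 0 0)))
    intro i hi
    induction hi using Nat.decreasingInduction with
    | self => exact hc
    | of_succ k hk ih => rw [← h1 k (by omega), ih]

theorem existsUnique_lElt (x : Module.Basis (Fin 2) K V) {Q : Fin 2 → Fin 2 → K}
    (hQ : ∀ i j, Q i j ≠ 0) {n j : ℕ} (hn : uNorm Q n ≠ 0)
    (hnJ : n ∈ setJ (Q 0 0) (Q 0 1 * Q 1 0) (Q 1 1))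
    (hjJ : j ∈ setJ (Q 0 0) (Q 0 1 * Q 1 0) (Q 1 1)) (hjn : j < n)
    (hX : Q 0 0 ^ (n + j - 1) * (Q 0 1 * Q 1 0) ^ 2 = 1) : ∃! L, IsLElt x Q n j L := by
  refine existsUnique_of_exists_of_unique ?_ ?_
  · have hjn' := add_comm n j ▸ (((mem_setJ_iff _ _ _ n).1 hnJ).2 j hjJ hjn)
    have hsum := sum_pow_adIter_eq_zero (hQ 0 0) (Q 0 1 * Q 1 0) hjn
      (qNum_ne_zero hn (by omega) (by omega)) hX
      hjn'.1 hjn'.2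
    obtain ⟨k, rfl⟩ := Nat.exists_eq_add_of_lt hjn
    rw [show j + k + 1 - j - 1 = k by omega] at hsum
    set C := adIter (Q 0 0) (Q 0 0)⁻¹ (Q 0 1 * Q 1 0) j k with hC
    -- The partial sums solve the difference equation that $d_1$ imposes. The scalar undoes the
    -- factor $(-q_{21})^k$ in `adGen_pow_pElt`. The end value $a_n=0$ serves twice: it puts the
    -- element in $U'_n$ and, with $a_0=0$, makes $d_2$ vanish on it.
    set a : ℕ → K := fun i => ((-Q 1 0) ^ k)⁻¹ * ∑ t ∈ Finset.range i, (Q 0 0)⁻¹ ^ t * C t with ha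
    have ha0 : a 0 = 0 := by simp [ha]
    have han : a (j + k + 1) = 0 := by simp only [ha, hsum, mul_zero]
    have hk : (-Q 1 0) ^ k ≠ 0 := pow_ne_zero _ (neg_ne_zero.2 (hQ 1 0))
    have hd : skewDer x Q 0 (pairSum x Q (j + k + 1) a) =
        (-Q 1 0) • (adGen x Q 0 ^ k) (pElt x Q j) := by
      rw [skewDer_zero_pairSum_succ x hn]
      congr 1
      have h1 : (fun i => Q 0 0 ^ i * (a (i + 1) - a i)) = ((-Q 1 0) ^ k)⁻¹ • C := by
        funext i
        have hq : Q 0 0 ^ i * (Q 0 0)⁻¹ ^ i = 1 := by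
          rw [← mul_pow, mul_inv_cancel₀ (hQ 0 0), one_pow]
        simp only [ha, Finset.sum_range_succ, Pi.smul_apply, smul_eq_mul]
        linear_combination ((-Q 1 0) ^ k)⁻¹ * C i * hq
      rw [h1, map_smul, hC, ← adGen_pow_pElt x hQ (uNorm_ne_zero_of_le hn (Nat.le_succ _)),
        inv_smul_smul₀ hk]
    refine ⟨pairSum x Q (j + k + 1) a, Submodule.mem_inf.2
      ⟨pairSum_mem_uSpace' x Q han, vanishing_le_kerPi x Q ?_⟩, ?_⟩
    · rw [mem_vanishing_iff]
      refine ⟨aug_pairSum x Q _ a, fun i => ?_⟩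
      fin_cases i
      · change skewDer x Q 0 _ ∈ _
        rw [hd]
        exact Submodule.smul_mem _ _ (adGen_pow_mem_vanishing (pElt_mem_vanishing x
          (uNorm_ne_zero_of_le hn hjn.le) ((mem_setJ_iff _ _ _ j).1 hjJ).1) k)
      · change skewDer x Q 1 _ ∈ _
        rw [skewDer_one_pairSum, ha0, han]
        simp
    · rw [hd, smul_smul, show j + k + 1 - j - 1 = k by omega, neg_mul_neg,
        inv_mul_cancel₀ (hQ 1 0), one_smul]
  · rintro L L' ⟨hL, hdL⟩ ⟨hL', hdL'⟩
    have h1 : L - L' ∈ uSpace' x Q n := Submodule.sub_mem _ hL.1 hL'.1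
    refine sub_eq_zero.1 (eq_zero_of_mem_uSpace'_of_skewDer_eq_zero hQ hn h1 ?_)
    rw [map_sub, sub_eq_zero]
    rw [← hdL'] at hdL
    exact (smul_right_injective _ (neg_ne_zero.2 (inv_ne_zero (hQ 1 0)))) hdL

/-! ### The set $J_2$ and the index $j_n$ -/

theorem exists_mem_setJ_of_mem_J2 {Q : Fin 2 → Fin 2 → K} {n : ℕ} (hn : n ∈ J2 Q) :
    ∃ j ∈ setJ (Q 0 0) (Q 0 1 * Q 1 0) (Q 1 1), j < n ∧
      Q 0 0 ^ (n + j - 1) * (Q 0 1 * Q 1 0) ^ 2 = 1 ∧ ((n - j : ℕ) : K) = 0 := by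
  obtain ⟨-, j, hj, hjn, he, ho⟩ := hn
  refine ⟨j, hj, hjn, ?_⟩
  rw [ringChar.spec, add_comm n j]
  rcases Nat.even_or_odd (n - j) with h | h
  · exact ⟨(he h).1, (Nat.dvd_mul_left _ 2).trans (he h).2⟩
  · refine ⟨?_, (ho h).2⟩
    obtain ⟨t, ht⟩ := h
    have h1 := (ho ⟨t, ht⟩).1
    rw [show (j + n - 1) / 2 = j + t by omega] at h1
    rw [show j + n - 1 = (j + t) * 2 by omega, pow_mul, ← mul_pow, h1]
    ring

theorem eq_one_of_pow_eq_one {Q : Fin 2 → Fin 2 → K} {m i : ℕ} (hm : uNorm Q m ≠ 0)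
    (hi : i ≠ 0) (him : i ≤ m) (h : Q 0 0 ^ i = 1) : Q 0 0 = 1 := by
  have h1 : qNum (Q 0 0) i * (Q 0 0 - 1) = Q 0 0 ^ i - 1 := geom_sum_mul _ _
  rw [h, sub_self] at h1
  exact sub_eq_zero.1 ((mul_eq_zero.1 h1).resolve_left (qNum_ne_zero hm hi him))

/-- Such a power would force $q=1$, and then $(n-j)_q=n-j$ is zero in $K$ for the $j$ witnessing
$n\in J_2$. -/
theorem pow_ne_one_of_mem_J2 {Q : Fin 2 → Fin 2 → K} {m n : ℕ} (hm : uNorm Q m ≠ 0)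
    (hn : n ∈ J2 Q) (hnm : n ≤ m) {i : ℕ} (hi : i ≠ 0) (him : i ≤ m) : Q 0 0 ^ i ≠ 1 := by
  intro h
  obtain ⟨j, -, hjn, -, h0⟩ := exists_mem_setJ_of_mem_J2 hn
  refine qNum_ne_zero hm (by omega : n - j ≠ 0) (by omega) ?_
  rw [eq_one_of_pow_eq_one hm hi him h, qNum]
  simpa using h0

theorem pow_sub_eq_one {q r : K} {a b : ℕ} (hab : a ≤ b) (ha : q ^ a * r ^ 2 = 1)
    (hb : q ^ b * r ^ 2 = 1) : q ^ (b - a) = 1 := by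
  obtain ⟨k, rfl⟩ := Nat.exists_eq_add_of_le hab
  rw [Nat.add_sub_cancel_left]
  rw [pow_add] at hb
  linear_combination hb - q ^ k * ha

/-- An $i<j$ in $J$ with $q^{i+j-1}r^2=1$ would give $q^{n-i}=1$. -/
theorem mem_J1_of_index {Q : Fin 2 → Fin 2 → K} {m n j : ℕ} (hm : uNorm Q m ≠ 0)
    (hn : n ∈ J2 Q) (hnm : n ≤ m) (hj : j ∈ setJ (Q 0 0) (Q 0 1 * Q 1 0) (Q 1 1)) (hjn : j < n)
    (hX : Q 0 0 ^ (n + j - 1) * (Q 0 1 * Q 1 0) ^ 2 = 1) : j ∈ J1 Q := by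
  refine ⟨hj, ((mem_setJ_iff _ _ _ j).1 hj).1, fun i _ hij h => ?_⟩
  have h1 := pow_sub_eq_one (by omega) h hX
  exact pow_ne_one_of_mem_J2 hm hn hnm (by omega) (by omega) h1

theorem existsUnique_index {Q : Fin 2 → Fin 2 → K} {m n : ℕ} (hm : uNorm Q m ≠ 0)
    (hn : n ∈ J2 Q) (hnm : n ≤ m) : ∃! j, IsIndexFor Q n j := by
  obtain ⟨j, hj, hjn, hX, -⟩ := exists_mem_setJ_of_mem_J2 hn
  have key : ∀ j j', IsIndexFor Q n j → IsIndexFor Q n j' → ¬ j < j' := fun j j' h h' hlt =>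
    pow_ne_one_of_mem_J2 hm hn hnm (by omega) (by have := h'.2.1; omega)
      (pow_sub_eq_one (by omega : n + j - 1 ≤ n + j' - 1) h.2.2 h'.2.2)
  refine existsUnique_of_exists_of_unique ⟨j, mem_J1_of_index hm hn hnm hj hjn hX, hjn, hX⟩
    fun j j' h h' => ?_
  exact le_antisymm (not_lt.1 (key j' j h' h)) (not_lt.1 (key j j' h h'))

/-! ### Linear independence of the relations -/

theorem skewDer_adGen_pow_pElt (x : Module.Basis (Fin 2) K V) {Q : Fin 2 → Fin 2 → K} {m j : ℕ}
    (hm : uNorm Q m ≠ 0) (hj : j ≤ m) :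
    skewDer x Q 0 ((adGen x Q 0 ^ (m + 1 - j)) (pElt x Q j)) =
      (qNum (Q 0 0) (m + 1 - j) * (1 - Q 0 0 ^ (m + j) * (Q 0 1 * Q 1 0) ^ 2)) •
        (adGen x Q 0 ^ (m - j)) (pElt x Q j) := by
  rw [show m + 1 - j = m - j + 1 by omega, skewDer_adGen_pow (pElt_mem_uSpace x Q j),
    skewDer_zero_pElt x (uNorm_ne_zero_of_le hm hj), map_zero, smul_zero, add_zero,
    show 2 * j + (m - j) = m + j by omega]

theorem IsLElt.mem_uSpace {x : Module.Basis (Fin 2) K V} {Q : Fin 2 → Fin 2 → K} {n j : ℕ}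
    {L : TensorAlgebra K V} (h : IsLElt x Q n j L) : L ∈ uSpace x Q n :=
  uSpace'_le x Q n h.1.1

theorem IsLElt.skewDer_eq {x : Module.Basis (Fin 2) K V} {Q : Fin 2 → Fin 2 → K}
    (hQ : ∀ i j, Q i j ≠ 0) {n j : ℕ} {L : TensorAlgebra K V} (h : IsLElt x Q n j L) :
    skewDer x Q 0 L = (-Q 1 0) • (adGen x Q 0 ^ (n - j - 1)) (pElt x Q j) := by
  rw [← h.2, smul_smul, neg_mul_neg, mul_inv_cancel₀ (hQ 1 0), one_smul]

theorem IsLElt.skewDer_adGen_pow {x : Module.Basis (Fin 2) K V} {Q : Fin 2 → Fin 2 → K}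
    (hQ : ∀ i j, Q i j ≠ 0) {m n j : ℕ} {L : TensorAlgebra K V} (h : IsLElt x Q n j L)
    (hjn : j < n) (hnm : n ≤ m) :
    skewDer x Q 0 ((adGen x Q 0 ^ (m + 1 - n)) L) =
      (qNum (Q 0 0) (m + 1 - n) * (1 - Q 0 0 ^ (m + n) * (Q 0 1 * Q 1 0) ^ 2)) •
          (adGen x Q 0 ^ (m - n)) L +
        (Q 0 0 ^ (m + 1 - n) * -Q 1 0) • (adGen x Q 0 ^ (m - j)) (pElt x Q j) := by
  rw [show m + 1 - n = m - n + 1 by omega, NicholsDiag.skewDer_adGen_pow h.mem_uSpace,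
    h.skewDer_eq hQ, map_smul, ← Module.End.mul_apply, ← pow_add, smul_smul,
    show 2 * n + (m - n) = m + n by omega, show m - n + 1 + (n - j - 1) = m - j by omega]

/-- Two different indices in `J₁` cannot both be degenerate with respect to `m + 1`. -/
theorem not_lt_of_mem_J1 {Q : Fin 2 → Fin 2 → K} {m i i' : ℕ} (hm : uNorm Q (m + 1) ≠ 0)
    (hi : i ∈ J1 Q) (hi' : i' ∈ J1 Q) (hm' : i' ≤ m + 1)
    (h : i ≤ m → Q 0 0 ^ (m + i) * (Q 0 1 * Q 1 0) ^ 2 = 1)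
    (h' : i' ≤ m → Q 0 0 ^ (m + i') * (Q 0 1 * Q 1 0) ^ 2 = 1) : ¬ i < i' := by
  intro hlt
  have h1 := h (by omega)
  refine hi'.2.2 i hi.1 hlt ?_
  -- If $i'\le m$, the two equations give $q=1$, hence $r^2=1$; if $i'=m+1$, the first equation is
  -- already the one excluded by $i'\in J_1$.
  rcases hm'.lt_or_eq with hlt' | rfl
  · have h2 := h' (by omega)
    have hq := eq_one_of_pow_eq_one hm (by omega) (by omega)
      (pow_sub_eq_one (by omega : m + i ≤ m + i') h1 h2)
    rw [hq, one_pow] at h1 ⊢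
    exact h1
  · rw [show i + (m + 1) - 1 = m + i by omega, h1]

/-- Applying $d_1$ to a relation at level $m+1$ gives one at level $m$: each term is scaled by
$\mu_n$, and the term of $L_n$ also contributes $\nu_n(\mathrm{ad}\,x_1)^{m-j_n}(P_{j_n})$. As
$j_n\in J_1$, the new relation has the same shape. -/
theorem coeff_eq_zero_of_sum_eq_zero (x : Module.Basis (Fin 2) K V) {Q : Fin 2 → Fin 2 → K}
    (hQ : ∀ i j, Q i j ≠ 0) {m : ℕ} (hm : uNorm Q m ≠ 0) {L : ℕ → TensorAlgebra K V} {f : ℕ → ℕ}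
    (hf : ∀ n ∈ J2 Q, n ≤ m → IsIndexFor Q n (f n))
    (hL : ∀ n ∈ J2 Q, n ≤ m → IsLElt x Q n (f n) (L n)) {a b : ℕ → K}
    (ha : ∀ n, a n ≠ 0 → n ∈ J1 Q) (hb : ∀ n, b n ≠ 0 → n ∈ J2 Q)
    (h : ∑ n ∈ Finset.range (m + 1), (a n • (adGen x Q 0 ^ (m - n)) (pElt x Q n) +
      b n • (adGen x Q 0 ^ (m - n)) (L n)) = 0) :
    ∀ n ≤ m, a n = 0 ∧ b n = 0 := by
  have hP : ∀ n ≤ m, (adGen x Q 0 ^ (m - n)) (pElt x Q n) ≠ 0 := fun n hn =>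
    adGen_pow_pElt_ne_zero x hQ (by rwa [Nat.add_sub_cancel' hn])
  induction m generalizing a b with
  | zero =>
    have hb0 : b 0 = 0 := by
      by_contra h0
      exact absurd (hf 0 (hb 0 h0) le_rfl).2.1 (Nat.not_lt_zero _)
    rw [Finset.sum_range_one, hb0, zero_smul, add_zero] at h
    intro n hn
    rw [Nat.le_zero.1 hn]
    exact ⟨(smul_eq_zero.1 h).resolve_right (hP 0 le_rfl), hb0⟩
  | succ m ih =>
    have hm' : uNorm Q m ≠ 0 := uNorm_ne_zero_of_le hm m.le_succ
    set μ : ℕ → K := fun n =>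
      qNum (Q 0 0) (m + 1 - n) * (1 - Q 0 0 ^ (m + n) * (Q 0 1 * Q 1 0) ^ 2) with hμ
    have hμ0 : ∀ n ≤ m, μ n = 0 → Q 0 0 ^ (m + n) * (Q 0 1 * Q 1 0) ^ 2 = 1 := fun n hn h0 =>
      (sub_eq_zero.1 ((mul_eq_zero.1 h0).resolve_left
        (qNum_ne_zero hm (by omega) (by omega)))).symm
    set ν : ℕ → K := fun n => Q 0 0 ^ (m + 1 - n) * -Q 1 0 with hν
    set a' : ℕ → K := fun i => (a i * μ i) +
      ∑ n ∈ Finset.range (m + 2), if f n = i then b n * ν n else 0 with ha'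
    have hsum : ∑ n ∈ Finset.range (m + 1), (a' n • (adGen x Q 0 ^ (m - n)) (pElt x Q n) +
        (b n * μ n) • (adGen x Q 0 ^ (m - n)) (L n)) = 0 := by
      have hd := congrArg (skewDer x Q 0) h
      rw [map_zero, map_sum] at hd
      have hterm : ∀ n ∈ Finset.range (m + 2),
          skewDer x Q 0 (a n • (adGen x Q 0 ^ (m + 1 - n)) (pElt x Q n) +
            b n • (adGen x Q 0 ^ (m + 1 - n)) (L n)) =
          ((if n ≤ m then (a n * μ n) • (adGen x Q 0 ^ (m - n)) (pElt x Q n) +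
            (b n * μ n) • (adGen x Q 0 ^ (m - n)) (L n) else 0) +
            (b n * ν n) • (adGen x Q 0 ^ (m - f n)) (pElt x Q (f n))) := by
        intro n hn
        have hn' := Finset.mem_range.1 hn
        have hPn : skewDer x Q 0 (a n • (adGen x Q 0 ^ (m + 1 - n)) (pElt x Q n)) =
            if n ≤ m then (a n * μ n) • (adGen x Q 0 ^ (m - n)) (pElt x Q n) else 0 := by
          split_ifs with hnm
          · rw [map_smul, skewDer_adGen_pow_pElt x hm' hnm, smul_smul]
          · rw [show n = m + 1 by omega, Nat.sub_self, pow_zero, Module.End.one_apply, map_smul,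
              skewDer_zero_pElt x hm, smul_zero]
        have hLn : skewDer x Q 0 (b n • (adGen x Q 0 ^ (m + 1 - n)) (L n)) =
            (if n ≤ m then (b n * μ n) • (adGen x Q 0 ^ (m - n)) (L n) else 0) +
              (b n * ν n) • (adGen x Q 0 ^ (m - f n)) (pElt x Q (f n)) := by
          by_cases hbn : b n = 0
          · simp [hbn]
          · have hJ := hb n hbn
            have hfn := (hf n hJ (by omega)).2.1
            have hLe := hL n hJ (by omega)
            split_ifs with hnm
            · rw [map_smul, hLe.skewDer_adGen_pow hQ hfn hnm, smul_add, smul_smul, smul_smul]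
            · obtain rfl : n = m + 1 := by omega
              rw [Nat.sub_self, pow_zero, Module.End.one_apply, map_smul, hLe.skewDer_eq hQ,
                zero_add, smul_smul, show m + 1 - f (m + 1) - 1 = m - f (m + 1) by omega, hν]
              simp
        rw [map_add, hPn, hLn]
        split_ifs
        · rw [add_assoc]
        · rw [zero_add]
      rw [Finset.sum_congr rfl hterm, Finset.sum_add_distrib, Finset.sum_range_succ,
        if_neg (by omega), add_zero] at hd
      have h1 : ∑ n ∈ Finset.range (m + 2),
          (b n * ν n) • (adGen x Q 0 ^ (m - f n)) (pElt x Q (f n)) =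
          ∑ i ∈ Finset.range (m + 1), (∑ n ∈ Finset.range (m + 2),
            if f n = i then b n * ν n else 0) • (adGen x Q 0 ^ (m - i)) (pElt x Q i) := by
        simp only [Finset.sum_smul]
        rw [Finset.sum_comm]
        refine Finset.sum_congr rfl fun n hn => ?_
        by_cases hbn : b n = 0
        · simp [hbn]
        · have hn' := Finset.mem_range.1 hn
          have hfn := (hf n (hb n hbn) (by omega)).2.1
          rw [Finset.sum_eq_single (f n), if_pos rfl]
          · intro i _ hi; rw [if_neg hi.symm, zero_smul]
          · intro h0; exact absurd (Finset.mem_range.2 (by omega)) h0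
      rw [h1, ← Finset.sum_add_distrib] at hd
      rw [← hd]
      refine Finset.sum_congr rfl fun n hn => ?_
      rw [if_pos (Nat.lt_succ_iff.1 (Finset.mem_range.1 hn)), ha', add_smul]
      abel
    have hzero := ih hm' (fun n hn h => hf n hn (by omega)) (fun n hn h => hL n hn (by omega))
      (a := a') (b := fun n => b n * μ n) (fun i hi => by
        by_contra hiJ
        have hai : a i = 0 := by by_contra h0; exact hiJ (ha i h0)
        refine hi ?_
        simp only [ha', hai, zero_mul, zero_add]
        refine Finset.sum_eq_zero fun n hn => ?_
        have hn' := Finset.mem_range.1 hn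
        split_ifs with hfi
        · by_cases hbn : b n = 0
          · rw [hbn, zero_mul]
          · exact absurd (hfi ▸ (hf n (hb n hbn) (by omega)).1) hiJ
        · rfl) (fun n hn => hb n (left_ne_zero_of_mul hn)) hsum
      (fun n hn => adGen_pow_pElt_ne_zero x hQ (by rwa [Nat.add_sub_cancel' hn]))
    -- If $b_n\ne0$ then $\mu_n=0$, so $q^{m+n}r^2=1=q^{n+j_n-1}r^2$ and $q^{m+1-j_n}=1$, which is
    -- excluded.
    have hblow : ∀ n ≤ m, b n = 0 := by
      intro n hn
      by_contra hbn
      have hJ := hb n hbn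
      have hfn := hf n hJ (by omega)
      have h1 := hμ0 n hn ((mul_eq_zero.1 (hzero n hn).2).resolve_left hbn)
      exact pow_ne_one_of_mem_J2 hm hJ (by omega) (by have := hfn.2.1; omega) (by omega)
        (pow_sub_eq_one (by have := hfn.2.1; omega : n + f n - 1 ≤ m + n) hfn.2.2 h1)
    have ha'eq : ∀ i, a' i = a i * μ i + if f (m + 1) = i then b (m + 1) * ν (m + 1) else 0 := by
      intro i
      simp only [ha']
      rw [Finset.sum_range_succ, Finset.sum_eq_zero, zero_add]
      intro n hn
      rw [hblow n (Nat.lt_succ_iff.1 (Finset.mem_range.1 hn)), zero_mul, ite_self]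
    -- For $j=j_{m+1}$ the defining equation of the index says exactly $\mu_j=0$, so $a'_j$ reduces
    -- to $-q_{21}b_{m+1}$.
    have hbtop : b (m + 1) = 0 := by
      by_contra hbn
      obtain ⟨-, hlt, hX⟩ := hf (m + 1) (hb _ hbn) le_rfl
      have h1 := (hzero (f (m + 1)) (by omega)).1
      rw [show m + 1 + f (m + 1) - 1 = m + f (m + 1) by omega] at hX
      rw [ha'eq, if_pos rfl] at h1
      simp only [hμ, hX, sub_self, mul_zero, zero_add, hν, Nat.sub_self, pow_zero, one_mul] at h1
      exact (mul_ne_zero hbn (neg_ne_zero.2 (hQ 1 0))) h1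
    have hball : ∀ n ≤ m + 1, b n = 0 := fun n hn => by
      rcases hn.lt_or_eq with h0 | rfl
      · exact hblow n (by omega)
      · exact hbtop
    -- Only indices with $\mu_i=0$, or $i=m+1$, can still carry a coefficient. By `not_lt_of_mem_J1`
    -- there is at most one, and its element is nonzero.
    have hX : ∀ i, a i ≠ 0 → i ≤ m → Q 0 0 ^ (m + i) * (Q 0 1 * Q 1 0) ^ 2 = 1 := by
      intro i hai hi
      have h1 := (hzero i hi).1
      rw [ha'eq, hbtop, zero_mul, ite_self, add_zero] at h1
      exact hμ0 i hi ((mul_eq_zero.1 h1).resolve_left hai)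
    intro n hn
    refine ⟨?_, hball n hn⟩
    by_contra han
    rw [Finset.sum_eq_single n, hball n hn, zero_smul, add_zero] at h
    · exact (smul_ne_zero han (hP n hn)) h
    · intro i hi hin
      have hi' := Finset.mem_range.1 hi
      have hai : a i = 0 := by
        by_contra hai
        have h1 := not_lt_of_mem_J1 hm (ha i hai) (ha n han) hn (hX i hai) (hX n han)
        have h2 := not_lt_of_mem_J1 hm (ha n han) (ha i hai) (by omega) (hX n han) (hX i hai)
        omega
      rw [hai, hball i (by omega), zero_smul, zero_smul, add_zero]
    · intro h0; exact absurd (Finset.mem_range.2 (by omega)) h0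

theorem sum_subtype_le_eq_sum_range {M : Type*} [AddCommMonoid M] {m : ℕ} (p : ℕ → Prop)
    [DecidablePred p] (hp : ∀ n, p n → n ≤ m) [Fintype (Subtype p)] (f : {n // p n} → M) :
    ∑ j, f j = ∑ n ∈ Finset.range (m + 1), if h : p n then f ⟨n, h⟩ else 0 := by
  have h1 := Finset.sum_subtype (F := ‹_›) ((Finset.range (m + 1)).filter p) (p := p)
    (fun n => by
      rw [Finset.mem_filter, Finset.mem_range]
      exact ⟨fun h => h.2, fun h => ⟨Nat.lt_succ_iff.2 (hp n h), h⟩⟩)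
    (fun n => if h : p n then f ⟨n, h⟩ else 0)
  rw [Finset.sum_filter_of_ne] at h1
  · rw [h1]
    exact Finset.sum_congr rfl fun j _ => by rw [dif_pos j.2]
  · intro n _ h
    by_contra h0
    exact h (dif_neg h0)

theorem linearIndependent_relFamily (x : Module.Basis (Fin 2) K V) {Q : Fin 2 → Fin 2 → K}
    (hQ : ∀ i j, Q i j ≠ 0) {m : ℕ} (hm : uNorm Q m ≠ 0) {L : ℕ → TensorAlgebra K V} {f : ℕ → ℕ}
    (hf : ∀ n ∈ J2 Q, n ≤ m → IsIndexFor Q n (f n))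
    (hL : ∀ n ∈ J2 Q, n ≤ m → IsLElt x Q n (f n) (L n)) :
    LinearIndependent K (relFamily x Q m L) := by
  classical
  have : Fintype {j : ℕ // j ∈ J1 Q ∧ j ≤ m} :=
    ((Set.finite_Iic m).subset fun j hj => hj.2 : {j : ℕ | j ∈ J1 Q ∧ j ≤ m}.Finite).fintype
  have : Fintype {n : ℕ // n ∈ J2 Q ∧ n ≤ m} :=
    ((Set.finite_Iic m).subset fun j hj => hj.2 : {j : ℕ | j ∈ J2 Q ∧ j ≤ m}.Finite).fintype
  rw [Fintype.linearIndependent_iff]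
  intro g hg
  rw [Fintype.sum_sum_type, sum_subtype_le_eq_sum_range _ fun _ h => h.2,
    sum_subtype_le_eq_sum_range _ fun _ h => h.2, ← Finset.sum_add_distrib] at hg
  have key := coeff_eq_zero_of_sum_eq_zero x hQ hm hf hL
    (a := fun n => if h : n ∈ J1 Q ∧ n ≤ m then g (Sum.inl ⟨n, h⟩) else 0)
    (b := fun n => if h : n ∈ J2 Q ∧ n ≤ m then g (Sum.inr ⟨n, h⟩) else 0)
    (fun n hn => by by_contra h0; exact hn (dif_neg fun h => h0 h.1))
    (fun n hn => by by_contra h0; exact hn (dif_neg fun h => h0 h.1))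
    (by
      rw [← hg]
      refine Finset.sum_congr rfl fun n _ => ?_
      congr 1
      · split_ifs with h
        · rfl
        · rw [zero_smul]
      · split_ifs with h
        · rfl
        · rw [zero_smul])
  rintro (⟨n, hn⟩ | ⟨n, hn⟩)
  · simpa [hn] using (key n hn.2).1
  · simpa [hn] using (key n hn.2).2

end Relations

end NicholsDiag

end

theorem mainTheorem6 {K : Type*} [Field K] {V : Type*} [AddCommGroup V] [Module K V]
    (x : Module.Basis (Fin 2) K V) (Q : Fin 2 → Fin 2 → K) (hQ : ∀ i j, Q i j ≠ 0)
    (m : ℕ) (hm : qFact (Q 0 0) m * bProd (Q 0 0) (Q 0 1 * Q 1 0) m ≠ 0) :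
    (∀ n ∈ J2 Q, n ≤ m → ∃! j, IsIndexFor Q n j) ∧
    (∀ n ∈ J2 Q, n ≤ m → ∀ j, IsIndexFor Q n j → ∃! L, IsLElt x Q n j L) ∧
    ∀ L : ℕ → TensorAlgebra K V,
      (∀ n ∈ J2 Q, n ≤ m → ∀ j, IsIndexFor Q n j → IsLElt x Q n j (L n)) →
      (∀ i, relFamily x Q m L i ∈ kerPi x Q ⊓ uSpace x Q m) ∧
      LinearIndependent K (relFamily x Q m L) := by
  refine ⟨fun n hn hnm => existsUnique_index hm hn hnm, fun n hn hnm j hj =>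
    existsUnique_lElt x hQ (uNorm_ne_zero_of_le hm hnm) hn.1 hj.1.1 hj.2.1 hj.2.2, fun L hL => ?_⟩
  -- The index is made a total function of $n$, with junk value $0$ outside $J_2\cap[0,m]$.
  have hex : ∀ n, ∃ j, n ∈ J2 Q → n ≤ m → IsIndexFor Q n j := fun n => by
    by_cases h : n ∈ J2 Q ∧ n ≤ m
    · obtain ⟨j, hj, -⟩ := existsUnique_index hm h.1 h.2
      exact ⟨j, fun _ _ => hj⟩
    · exact ⟨0, fun h1 h2 => absurd ⟨h1, h2⟩ h⟩
  choose f hf using hex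
  have hL' : ∀ n ∈ J2 Q, n ≤ m → IsLElt x Q n (f n) (L n) := fun n hn hnm =>
    hL n hn hnm _ (hf n hn hnm)
  refine ⟨?_, linearIndependent_relFamily x hQ hm hf hL'⟩
  rintro (⟨n, hn, hnm⟩ | ⟨n, hn, hnm⟩)
  · refine Submodule.mem_inf.2 ⟨vanishing_le_kerPi x Q (adGen_pow_mem_vanishing
      (pElt_mem_vanishing x (uNorm_ne_zero_of_le hm hnm) hn.2.1) _), ?_⟩
    have h := adGen_pow_mem_uSpace (pElt_mem_uSpace x Q n) (m - n)
    rwa [Nat.add_sub_cancel' hnm] at h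
  · have hLn := hL' n hn hnm
    refine Submodule.mem_inf.2 ⟨adGen_pow_mem_kerPi hLn.1.2 hLn.mem_uSpace _, ?_⟩
    have h := adGen_pow_mem_uSpace hLn.mem_uSpace (m - n)
    rwa [Nat.add_sub_cancel' hnm] at h
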